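/- Let $\mathcal R=[x_l,x_l+L]\times[y_l,y_l+L]$ with $L>0$, let $K\le 0$ and $\sigma\ge 0$ be constants, and let $\partial\mathcal R=\partial\mathcal R_1\cup\partial\mathcal R_2$ be a disjoint decomposition in which $\partial\mathcal R_2$ contains no corner of $\mathcal R$. Consider $$\Delta u+Ku=f\ \text{ in }\mathcal R,\qquad u=u_1\ \text{ on }\partial\mathcal R_1,\qquad \frac{\partial u}{\partial n}+\sigma u=g\ \text{ on }\partial\mathcal R_2,$$ where $n$ is the outward unit normal. For $N\ge1$ let $h=L/N$, $x_i=x_l+ih$, $y_j=y_l+jh$ ($0\le i,j\le N$), $f_{ij}=f(x_i,y_j)$ and $\lambda=12-Kh^2$. The finite difference solution $U_{ij}$ is defined by the following equations. (a) At the interior grid points, $(L_h+KM_h)U_{ij}=M_hf_{ij}$, where $L_h$ is the nine-point Laplacian with coefficients $\frac1{6h^2}$ at the four corners of the stencil, $\frac4{6h^2}$ at the east, north, south and west points and $-\frac{20}{6h^2}$ at the center, and $M_hf_{ij}=\frac1{12}\left(f_{i-1,j}+f_{i+1,j}+f_{i,j-1}+f_{i,j+1}+8f_{ij}\right)$. (b)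 At the boundary grid points in $\partial\mathcal R_1$, $U_{ij}=u_1(x_i,y_j)$. (c) At a boundary grid point $(x_0,y_j)\in\partial\mathcal R_2$ on the left side, $$\frac1{\lambda h^2}\Big[8U_{0,j+1}+8U_{0,j-1}+4U_{1,j+1}+4U_{1,j-1}+16U_{1,j}+\big(4\sigma Kh^3+\lambda Kh^2-24\sigma h-40\big)U_{0,j}\Big]$$ $$=\frac1\lambda\Big[f_{0,j+1}+f_{0,j-1}-f_{-1,j}+(8-Kh^2)f_{0,j}+3f_{1,j}\Big]+\frac{4Kh^2-24}{\lambda h}\,g(x_0,y_j),$$ and the rotated equation on the other three sides. Here $f_{-1,j}$ is a value assigned to $f$ at the point $(x_0-h,y_j)$ outside of $\mathcal R$ (an "$f$-extension"). Its defect is $\delta_j=\left|f_{-1,j}-(3f_{0,j}-3f_{1,j}+f_{2,j})\right|$, so $\delta_j=0$ for the quadratic extension; likewise on the other sides. Let $\|D^mu\|_{\infty,S}$ be the supremum over $S$ of the absolute values of all partial derivatives of $u$ of order $m$. Then: 1. For every $N\ge 1$ and all data the finite difference equations have a unique solution. 2. (Exactness) If $K=\sigma=0$ and the solution $u$ is a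 polynomial of degree at most four, then, with the quadratic extension of $f$, $U_{ij}=u(x_i,y_j)$ at all grid points, for every $N\ge 1$. 3. (Convergence) If $K=\sigma=0$, assume in addition that $\partial\mathcal R_1$ contains a nondegenerate segment. Put $$B(u)=\max\{\|D^6u\|_{\infty,\mathcal R},\ \|D^5u\|_{\infty,\partial\mathcal R}\},\qquad B_K(u)=\max\{B(u),\ |K|\,\|D^3u\|_{\infty,\partial\mathcal R}\},$$ so that $B_0=B$. (i) For every $E$ there is a constant $C$, depending only on $\mathcal R$, $\partial\mathcal R_2$, $K$, $\sigma$ and $E$, such that for every $N\ge 1$, every solution $u\in C^6(\mathcal R)$ and every $f$-extension with defects at most $E\,B_K(u)\,h^3$, $$\max_{i,j}|u(x_i,y_j)-U_{ij}|\le C\,B_K(u)\,h^4 .$$ In particular, if $K=0$, this is the bound $C\max\{\|D^6u\|_{\infty,\mathcal R},\|D^5u\|_{\infty,\partial\mathcal R}\}h^4$ with $C$ independent of $u$ and $h$. (ii) For every solution $u\in C^6(\mathcal R)$ with $B(u)>0$ and every $E$ there is a constant $C$, which may depend on $u$, $\mathcal R$, $\partial\mathcal R_2$, $K$, $\sigma$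 and $E$ but not on $h$, such that for every $N\ge 1$ and every $f$-extension with defects at most $E\,h^3$, $$\max_{i,j}|u(x_i,y_j)-U_{ij}|\le C\,\max\{\|D^6u\|_{\infty,\mathcal R},\ \|D^5u\|_{\infty,\partial\mathcal R}\}\,h^4 .$$ -/

import Mathlib

/-- Data of the boundary value problem `Δu + K u = f` on the closed square
`[xl, xl + len] × [yl, yl + len]`, with the flux condition `∂u/∂n + σ u = g` on the part
`fluxPart` of the boundary and a Dirichlet condition on the rest of the boundary. -/
structure FluxProblem where
  xl : ℝ
  yl : ℝ
  len : ℝ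
  K : ℝ
  σ : ℝ
  fluxPart : Set (ℝ × ℝ)

/-- The four sides of a square. -/
inductive SquareSide where
  | left | right | bottom | top

namespace SquareSide

/-- Inward unit normal of a side, as a grid direction. -/
def inward : SquareSide → ℤ × ℤ
  | left => (1, 0)
  | right => (-1, 0)
  | bottom => (0, 1)
  | top => (0, -1)

/-- A unit tangent of a side, as a grid direction. -/
def tangent : SquareSide → ℤ × ℤ
  | left => (0, 1)
  | right => (0, 1)
  | bottom => (1, 0)
  | top => (1, 0)

end SquareSide

namespace FluxProblem

/-! ### The continuous problem -/

def xInterval (P : FluxProblem) : Set ℝ := Set.Icc P.xl (P.xl + P.len)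

def yInterval (P : FluxProblem) : Set ℝ := Set.Icc P.yl (P.yl + P.len)

/-- The closed square. -/
def domain (P : FluxProblem) : Set (ℝ × ℝ) := P.xInterval ×ˢ P.yInterval

/-- The boundary of the square. -/
def bdry (P : FluxProblem) : Set (ℝ × ℝ) :=
  {p | p ∈ P.domain ∧
    (p.1 = P.xl ∨ p.1 = P.xl + P.len ∨ p.2 = P.yl ∨ p.2 = P.yl + P.len)}

/-- A side of the square without its two end points. -/
def openSide (P : FluxProblem) : SquareSide → Set (ℝ × ℝ)
  | .left => {p | p.1 = P.xl ∧ p.2 ∈ Set.Ioo P.yl (P.yl + P.len)}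
  | .right => {p | p.1 = P.xl + P.len ∧ p.2 ∈ Set.Ioo P.yl (P.yl + P.len)}
  | .bottom => {p | p.1 ∈ Set.Ioo P.xl (P.xl + P.len) ∧ p.2 = P.yl}
  | .top => {p | p.1 ∈ Set.Ioo P.xl (P.xl + P.len) ∧ p.2 = P.yl + P.len}

/-- Partial derivative in `x` on the closed square (one-sided on the vertical sides). -/
noncomputable def dx (P : FluxProblem) (u : ℝ × ℝ → ℝ) : ℝ × ℝ → ℝ :=
  fun p => derivWithin (fun s => u (s, p.2)) P.xInterval p.1

/-- Partial derivative in `y` on the closed square (one-sided on the horizontal sides). -/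
noncomputable def dy (P : FluxProblem) (u : ℝ × ℝ → ℝ) : ℝ × ℝ → ℝ :=
  fun p => derivWithin (fun t => u (p.1, t)) P.yInterval p.2

/-- The Laplacian on the closed square. -/
noncomputable def laplacian (P : FluxProblem) (u : ℝ × ℝ → ℝ) : ℝ × ℝ → ℝ :=
  fun p => P.dx (P.dx u) p + P.dy (P.dy u) p

/-- Outward normal derivative on a side. -/
noncomputable def normalDeriv (P : FluxProblem) (s : SquareSide) (u : ℝ × ℝ → ℝ) : ℝ × ℝ → ℝ :=
  fun p => -((s.inward.1 : ℝ) * P.dx u p + (s.inward.2 : ℝ) * P.dy u p)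

/-- `u` is a solution, of class `C⁶` up to the boundary, of the boundary value problem with source
`f`, flux data `g` and Dirichlet data `u₁`. -/
structure IsSolution (P : FluxProblem) (u f g u₁ : ℝ × ℝ → ℝ) : Prop where
  smooth : ContDiffOn ℝ 6 u P.domain
  pde : ∀ p ∈ P.domain, P.laplacian u p + P.K * u p = f p
  dirichlet : ∀ p ∈ P.bdry, p ∉ P.fluxPart → u p = u₁ p
  flux : ∀ s, ∀ p ∈ P.openSide s, p ∈ P.fluxPart → P.normalDeriv s u p + P.σ * u p = g p

/-- `‖Dⁿ u‖_{∞,S}`: the supremum over `S` of the absolute values of all partial derivatives of `u`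
of order exactly `n`. -/
noncomputable def supDeriv (P : FluxProblem) (n : ℕ) (u : ℝ × ℝ → ℝ) (S : Set (ℝ × ℝ)) : ℝ :=
  sSup {r | ∃ p ∈ S, ∃ i j : ℕ, i + j = n ∧ r = |P.dx^[i] (P.dy^[j] u) p|}

/-- `max {‖D⁶ u‖_{∞,R}, ‖D⁵ u‖_{∞,∂R}}`. -/
noncomputable def derivBound (P : FluxProblem) (u : ℝ × ℝ → ℝ) : ℝ :=
  max (P.supDeriv 6 u P.domain) (P.supDeriv 5 u P.bdry)

/-! ### The compact scheme -/

/-- The mesh size. -/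
noncomputable def h (P : FluxProblem) (N : ℕ) : ℝ := P.len / N

/-- The grid point with a given (integer) index pair. -/
noncomputable def node (P : FluxProblem) (N : ℕ) (k : ℤ × ℤ) : ℝ × ℝ :=
  (P.xl + k.1 * P.h N, P.yl + k.2 * P.h N)

/-- The index set `{0, …, N}²` of the grid. -/
def grid (N : ℕ) : Set (ℤ × ℤ) := {k | 0 ≤ k.1 ∧ k.1 ≤ N ∧ 0 ≤ k.2 ∧ k.2 ≤ N}

/-- The indices of the interior grid points. -/
def interiorGrid (N : ℕ) : Set (ℤ × ℤ) := {k | 0 < k.1 ∧ k.1 < N ∧ 0 < k.2 ∧ k.2 < N}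

/-- The indices of the grid points on a side, corners excluded. -/
def sideGrid (N : ℕ) : SquareSide → Set (ℤ × ℤ)
  | .left => {k | k.1 = 0 ∧ 0 < k.2 ∧ k.2 < N}
  | .right => {k | k.1 = N ∧ 0 < k.2 ∧ k.2 < N}
  | .bottom => {k | 0 < k.1 ∧ k.1 < N ∧ k.2 = 0}
  | .top => {k | 0 < k.1 ∧ k.1 < N ∧ k.2 = N}

/-- The nine-point Laplacian. -/
noncomputable def Lh (P : FluxProblem) (N : ℕ) (U : ℤ × ℤ → ℝ) (k : ℤ × ℤ) : ℝ :=
  1 / (6 * P.h N ^ 2) *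
    (U (k + (1, 1)) + U (k + (1, -1)) + U (k + (-1, 1)) + U (k + (-1, -1))
      + 4 * (U (k + (1, 0)) + U (k + (-1, 0)) + U (k + (0, 1)) + U (k + (0, -1)))
      - 20 * U k)

/-- The averaging operator of the nine-point scheme. -/
noncomputable def Mh (F : ℤ × ℤ → ℝ) (k : ℤ × ℤ) : ℝ :=
  1 / 12 * (F (k + (-1, 0)) + F (k + (1, 0)) + F (k + (0, -1)) + F (k + (0, 1)) + 8 * F k)

/-- `λ = 12 - K h²`. -/
noncomputable def lam (P : FluxProblem) (N : ℕ) : ℝ := 12 - P.K * P.h N ^ 2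

/-- The six-point combination of the values `U` at a flux boundary point: the first column of
coefficients is on the boundary line, the second on the next grid line inside. -/
noncomputable def fluxLhs (P : FluxProblem) (N : ℕ) (s : SquareSide) (U : ℤ × ℤ → ℝ)
    (k : ℤ × ℤ) : ℝ :=
  1 / (P.lam N * P.h N ^ 2) *
    (8 * U (k + s.tangent) + 4 * U (k + s.inward + s.tangent)
      + (4 * P.σ * P.K * P.h N ^ 3 + P.lam N * P.K * P.h N ^ 2 - 24 * P.σ * P.h N - 40) * U k
      + 16 * U (k + s.inward)
      + 8 * U (k - s.tangent) + 4 * U (k + s.inward - s.tangent))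

/-- The combination of the source values `F` (with one value outside of the square) and of the flux
data `g` at a flux boundary point. -/
noncomputable def fluxRhs (P : FluxProblem) (N : ℕ) (s : SquareSide) (F : ℤ × ℤ → ℝ)
    (g : ℝ × ℝ → ℝ) (k : ℤ × ℤ) : ℝ :=
  1 / P.lam N *
    (F (k + s.tangent) - F (k - s.inward) + (8 - P.K * P.h N ^ 2) * F k + 3 * F (k + s.inward)
      + F (k - s.tangent))
    + (4 * P.K * P.h N ^ 2 - 24) / (P.lam N * P.h N) * g (P.node N k)

/-- `U` is a finite difference solution for the source values `F`, the flux data `g` and the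
Dirichlet data `u₁`. -/
structure IsDiscreteSolution (P : FluxProblem) (N : ℕ) (F : ℤ × ℤ → ℝ) (g u₁ : ℝ × ℝ → ℝ)
    (U : ℤ × ℤ → ℝ) : Prop where
  interior : ∀ k ∈ interiorGrid N, P.Lh N U k + P.K * Mh U k = Mh F k
  dirichlet : ∀ k ∈ grid N, P.node N k ∈ P.bdry → P.node N k ∉ P.fluxPart → U k = u₁ (P.node N k)
  flux : ∀ s, ∀ k ∈ sideGrid N s, P.node N k ∈ P.fluxPart →
    P.fluxLhs N s U k = P.fluxRhs N s F g k

/-- `F` consists of the values of `f` on the grid, together with one value outside of the square for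
every flux boundary point, which differs by at most `δ` from the quadratic extrapolation of `f`
along the grid line normal to the side. For `δ = 0` this is the quadratic extension of `f`. -/
structure IsSourceExtension (P : FluxProblem) (N : ℕ) (f : ℝ × ℝ → ℝ) (δ : ℝ)
    (F : ℤ × ℤ → ℝ) : Prop where
  on_grid : ∀ k ∈ grid N, F k = f (P.node N k)
  outside : ∀ s, ∀ k ∈ sideGrid N s, P.node N k ∈ P.fluxPart →
    |F (k - s.inward) - (3 * F k - 3 * F (k + s.inward) + F (k + s.inward + s.inward))| ≤ δ

/-- The Dirichlet part of the boundary contains a nondegenerate piece of the boundary. -/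
def HasDirichletSegment (P : FluxProblem) : Prop :=
  ∃ p ∈ P.bdry, ∃ ε > 0, ∀ q ∈ P.bdry, dist q p < ε → q ∉ P.fluxPart

end FluxProblem

namespace FluxProblem

/-! ### Partial derivatives on the closed square -/

section PartialDerivatives

variable {P : FluxProblem} {u v : ℝ × ℝ → ℝ} {p : ℝ × ℝ}

/-! The error bound is consistency plus stability, with one power of h lost at the boundary and
regained from the stability estimate.

Consistency. For smooth u the nine-point Laplacian of u and the average M_h of Δu have the same
expansion Δu + (h²/12)Δ²u + O(h⁴), so the interior residual is O(h⁴) (`abs_Lh_sub_Mh_laplacian_le`);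
the terms in K cancel, since M_h acts on Ku on both sides. In the flux formula all Taylor terms of
order below five cancel, and those multiplied by Kh² cancel below order three; after division by λh²
the residual is O(h³) (`abs_fluxLhs_sub_fluxRhs_le`). The bounds on D⁵u and D³u that this needs on
the whole square come from their boundary values and from higher derivatives by mean value arguments
(`derivLE_five`, `derivLE_three`).

Stability. A flux row is of size 1/h times the boundary condition, so an O(h³) residual there weighs
as much as an O(h⁴) residual inside. To use this, take a smooth w > 0 with Δw + Kw ≤ -2 and ∂w/∂n +
σw ≥ 1. The consistency estimates applied to w itself show that on fine grids it satisfies the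
discrete inequalities with -1 and -1/h (`IsBarrier.exists_discrete`), and comparison with w bounds
the error (`abs_le_of_barrier`). The finitely many coarse grids, where the comparison may fail, are
covered by invertibility of each system. Barriers are explicit: a paraboloid if K < 0 or σ > 0, and
otherwise a paraboloid plus a pole placed just outside the Dirichlet part (`exists_isBarrier`).

Solvability on every grid is a diagonal dominance argument (`eq_zero_of_schemeOp_eq_zero`).
Exactness follows from it: for polynomials of degree at most four both residuals vanish, so the
error lies in the trivial kernel. -/

lemma uniqueDiffOn_domain (hl : 0 < P.len) : UniqueDiffOn ℝ P.domain :=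
  (uniqueDiffOn_Icc (by linarith)).prod (uniqueDiffOn_Icc (by linarith))

lemma convex_domain : Convex ℝ P.domain := (convex_Icc _ _).prod (convex_Icc _ _)

lemma isCompact_domain : IsCompact P.domain := isCompact_Icc.prod isCompact_Icc

lemma domain_subset_closure_interior (hl : 0 < P.len) :
    P.domain ⊆ closure (interior P.domain) := by
  intro p hp
  have hx : (interior (Set.Icc P.xl (P.xl + P.len))).Nonempty := by
    rw [interior_Icc]; exact Set.nonempty_Ioo.2 (by linarith)
  have hy : (interior (Set.Icc P.yl (P.yl + P.len))).Nonempty := by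
    rw [interior_Icc]; exact Set.nonempty_Ioo.2 (by linarith)
  have hne : (interior P.domain).Nonempty := by
    unfold domain xInterval yInterval
    rw [interior_prod_eq]; exact hx.prod hy
  rw [convex_domain.closure_interior_eq_closure_of_nonempty_interior hne]
  exact subset_closure hp

lemma hasDerivWithinAt_horizontal (hu : DifferentiableWithinAt ℝ u P.domain p)
    (hp : p ∈ P.domain) :
    HasDerivWithinAt (fun s => u (s, p.2)) (fderivWithin ℝ u P.domain p (1, 0))
      P.xInterval p.1 := by
  have h1 : HasDerivWithinAt (fun s : ℝ => (s, p.2)) ((1 : ℝ), (0 : ℝ)) P.xInterval p.1 :=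
    (hasDerivWithinAt_id _ _).prodMk (hasDerivWithinAt_const _ _ _)
  exact HasFDerivWithinAt.comp_hasDerivWithinAt (f := fun s : ℝ => (s, p.2)) p.1
    hu.hasFDerivWithinAt h1 (fun s hs => ⟨hs, hp.2⟩)

lemma hasDerivWithinAt_vertical (hu : DifferentiableWithinAt ℝ u P.domain p)
    (hp : p ∈ P.domain) :
    HasDerivWithinAt (fun t => u (p.1, t)) (fderivWithin ℝ u P.domain p (0, 1))
      P.yInterval p.2 := by
  have h1 : HasDerivWithinAt (fun t : ℝ => (p.1, t)) ((0 : ℝ), (1 : ℝ)) P.yInterval p.2 :=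
    (hasDerivWithinAt_const _ _ _).prodMk (hasDerivWithinAt_id _ _)
  exact HasFDerivWithinAt.comp_hasDerivWithinAt (f := fun t : ℝ => (p.1, t)) p.2
    hu.hasFDerivWithinAt h1 (fun s hs => ⟨hp.1, hs⟩)

lemma dx_eq_fderivWithin (hl : 0 < P.len) (hu : DifferentiableWithinAt ℝ u P.domain p)
    (hp : p ∈ P.domain) : P.dx u p = fderivWithin ℝ u P.domain p (1, 0) :=
  (hasDerivWithinAt_horizontal hu hp).derivWithin (uniqueDiffOn_Icc (by linarith) _ hp.1)

lemma dy_eq_fderivWithin (hl : 0 < P.len) (hu : DifferentiableWithinAt ℝ u P.domain p)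
    (hp : p ∈ P.domain) : P.dy u p = fderivWithin ℝ u P.domain p (0, 1) :=
  (hasDerivWithinAt_vertical hu hp).derivWithin (uniqueDiffOn_Icc (by linarith) _ hp.2)

lemma hasDerivWithinAt_dx (hl : 0 < P.len) (hu : DifferentiableWithinAt ℝ u P.domain p)
    (hp : p ∈ P.domain) :
    HasDerivWithinAt (fun s => u (s, p.2)) (P.dx u p) P.xInterval p.1 := by
  rw [dx_eq_fderivWithin hl hu hp]; exact hasDerivWithinAt_horizontal hu hp

lemma hasDerivWithinAt_dy (hl : 0 < P.len) (hu : DifferentiableWithinAt ℝ u P.domain p)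
    (hp : p ∈ P.domain) :
    HasDerivWithinAt (fun t => u (p.1, t)) (P.dy u p) P.yInterval p.2 := by
  rw [dy_eq_fderivWithin hl hu hp]; exact hasDerivWithinAt_vertical hu hp

/-- At a point of the square `derivWithin` only sees values on a segment inside it, so identities
between partial derivatives can be iterated while being known on the square alone. -/
lemma dx_congr (h : Set.EqOn u v P.domain) : Set.EqOn (P.dx u) (P.dx v) P.domain := by
  intro p hp
  exact derivWithin_congr (fun s hs => h ⟨hs, hp.2⟩) (h hp)

lemma dy_congr (h : Set.EqOn u v P.domain) : Set.EqOn (P.dy u) (P.dy v) P.domain := by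
  intro p hp
  exact derivWithin_congr (fun s hs => h ⟨hp.1, hs⟩) (h hp)

lemma dx_iterate_congr (h : Set.EqOn u v P.domain) (n : ℕ) :
    Set.EqOn (P.dx^[n] u) (P.dx^[n] v) P.domain := by
  induction n with
  | zero => exact h
  | succ n ih => simp only [Function.iterate_succ_apply']; exact dx_congr ih

lemma dy_iterate_congr (h : Set.EqOn u v P.domain) (n : ℕ) :
    Set.EqOn (P.dy^[n] u) (P.dy^[n] v) P.domain := by
  induction n with
  | zero => exact h
  | succ n ih => simp only [Function.iterate_succ_apply']; exact dy_congr ih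

lemma _root_.ContDiffOn.differentiableOn_of_succ {F : Type*} [NormedAddCommGroup F]
    [NormedSpace ℝ F] {f : ℝ × ℝ → F} {m : ℕ} {D : Set (ℝ × ℝ)}
    (hf : ContDiffOn ℝ (m + 1 : ℕ) f D) : DifferentiableOn ℝ f D :=
  hf.differentiableOn (by exact_mod_cast Nat.succ_ne_zero m)

lemma contDiffOn_dx (hl : 0 < P.len) {m : ℕ} (hu : ContDiffOn ℝ (m + 1 : ℕ) u P.domain) :
    ContDiffOn ℝ m (P.dx u) P.domain := by
  have h1 : ContDiffOn ℝ m (fderivWithin ℝ u P.domain) P.domain :=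
    hu.fderivWithin (uniqueDiffOn_domain hl) (by norm_cast)
  exact (h1.clm_apply contDiffOn_const).congr fun p hp =>
    dx_eq_fderivWithin hl (hu.differentiableOn_of_succ p hp) hp

lemma contDiffOn_dy (hl : 0 < P.len) {m : ℕ} (hu : ContDiffOn ℝ (m + 1 : ℕ) u P.domain) :
    ContDiffOn ℝ m (P.dy u) P.domain := by
  have h1 : ContDiffOn ℝ m (fderivWithin ℝ u P.domain) P.domain :=
    hu.fderivWithin (uniqueDiffOn_domain hl) (by norm_cast)
  exact (h1.clm_apply contDiffOn_const).congr fun p hp =>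
    dy_eq_fderivWithin hl (hu.differentiableOn_of_succ p hp) hp

/-- Mixed second partial derivatives agree up to the boundary of the square. -/
lemma dy_dx_eq_dx_dy (hl : 0 < P.len) (hu : ContDiffOn ℝ (2 : ℕ) u P.domain) :
    Set.EqOn (P.dy (P.dx u)) (P.dx (P.dy u)) P.domain := by
  intro p hp
  have hD := uniqueDiffOn_domain hl
  have h1 : ContDiffOn ℝ (0 + 1 : ℕ) (fderivWithin ℝ u P.domain) P.domain :=
    hu.fderivWithin hD (by norm_cast)
  have h1d := h1.differentiableOn_of_succ p hp
  have hud := hu.differentiableOn_of_succ (m := 1)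
  have key : ∀ w : ℝ × ℝ, ∀ z, fderivWithin ℝ (fun q => fderivWithin ℝ u P.domain q w) P.domain p z
      = fderivWithin ℝ (fderivWithin ℝ u P.domain) P.domain p z w := by
    intro w z
    rw [fderivWithin_clm_apply (hD p hp) h1d (differentiableWithinAt_const _)]
    simp
  have hx : Set.EqOn (P.dx u) (fun q => fderivWithin ℝ u P.domain q (1, 0)) P.domain :=
    fun q hq => dx_eq_fderivWithin hl (hud q hq) hq
  have hy : Set.EqOn (P.dy u) (fun q => fderivWithin ℝ u P.domain q (0, 1)) P.domain :=
    fun q hq => dy_eq_fderivWithin hl (hud q hq) hq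
  have hdiff : ∀ w : ℝ × ℝ, DifferentiableWithinAt ℝ (fun q => fderivWithin ℝ u P.domain q w)
      P.domain p := fun w => h1d.clm_apply (differentiableWithinAt_const _)
  rw [dy_congr hx hp, dx_congr hy hp, dy_eq_fderivWithin hl (hdiff _) hp,
    dx_eq_fderivWithin hl (hdiff _) hp, key, key]
  exact ((hu p hp).isSymmSndFDerivWithinAt (n := (2 : ℕ)) (by simp) hD
    (domain_subset_closure_interior hl hp) hp).eq _ _

/-- The partial derivative `∂ⁱₓ ∂ʲ_y u`. -/
noncomputable def partialDeriv (P : FluxProblem) (u : ℝ × ℝ → ℝ) (i j : ℕ) : ℝ × ℝ → ℝ :=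
  P.dx^[i] (P.dy^[j] u)

lemma contDiffOn_dy_iterate (hl : 0 < P.len) (m j : ℕ) (hu : ContDiffOn ℝ (m + j : ℕ) u P.domain) :
    ContDiffOn ℝ m (P.dy^[j] u) P.domain := by
  induction j generalizing m with
  | zero => exact hu
  | succ j ih =>
    rw [Function.iterate_succ_apply']
    exact contDiffOn_dy hl (ih (m + 1) (by rwa [Nat.add_right_comm]))

lemma contDiffOn_dx_iterate (hl : 0 < P.len) (m j : ℕ) (hu : ContDiffOn ℝ (m + j : ℕ) u P.domain) :
    ContDiffOn ℝ m (P.dx^[j] u) P.domain := by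
  induction j generalizing m with
  | zero => exact hu
  | succ j ih =>
    rw [Function.iterate_succ_apply']
    exact contDiffOn_dx hl (ih (m + 1) (by rwa [Nat.add_right_comm]))

lemma contDiffOn_partialDeriv (hl : 0 < P.len) {m n i j : ℕ} (hu : ContDiffOn ℝ n u P.domain)
    (h : i + j + m ≤ n) : ContDiffOn ℝ m (P.partialDeriv u i j) P.domain :=
  contDiffOn_dx_iterate hl m i (contDiffOn_dy_iterate hl (m + i) j
    (hu.of_le (by norm_cast; omega)))

lemma dx_partialDeriv (i j : ℕ) :
    P.dx (P.partialDeriv u i j) = P.partialDeriv u (i + 1) j := by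
  simp [partialDeriv, Function.iterate_succ_apply']

lemma dy_dx_iterate (hl : 0 < P.len) (i : ℕ) (hu : ContDiffOn ℝ (i + 1 : ℕ) u P.domain) :
    Set.EqOn (P.dy (P.dx^[i] u)) (P.dx^[i] (P.dy u)) P.domain := by
  induction i with
  | zero => exact fun _ _ => rfl
  | succ i ih =>
    simp only [Function.iterate_succ_apply']
    refine (dy_dx_eq_dx_dy hl (contDiffOn_dx_iterate hl 2 i (hu.of_le ?_))).trans
      (dx_congr (ih (hu.of_le ?_)))
    · norm_cast; omega
    · norm_cast; omega

/-- The y-derivatives are innermost in `partialDeriv`, so a further `dy` has to be commuted past all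
x-derivatives; unlike `dx_partialDeriv`, this uses smoothness and holds only on the square. -/
lemma dy_partialDeriv (hl : 0 < P.len) {n i j : ℕ} (hu : ContDiffOn ℝ n u P.domain)
    (h : i + j + 1 ≤ n) :
    Set.EqOn (P.dy (P.partialDeriv u i j)) (P.partialDeriv u i (j + 1)) P.domain := by
  refine (dy_dx_iterate hl i (contDiffOn_dy_iterate hl (i + 1) j (hu.of_le ?_))).trans ?_
  · norm_cast; omega
  · intro p _
    simp [partialDeriv, Function.iterate_succ_apply']

lemma dy_iterate_partialDeriv (hl : 0 < P.len) {n i j l : ℕ} (hu : ContDiffOn ℝ n u P.domain)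
    (h : i + j + l ≤ n) :
    Set.EqOn (P.dy^[l] (P.partialDeriv u i j)) (P.partialDeriv u i (j + l)) P.domain := by
  induction l with
  | zero => exact fun _ _ => rfl
  | succ l ih =>
    rw [Function.iterate_succ_apply']
    exact (dy_congr (ih (by omega))).trans (dy_partialDeriv hl hu (by omega))

lemma partialDeriv_partialDeriv (hl : 0 < P.len) {n i j k l : ℕ}
    (hu : ContDiffOn ℝ n u P.domain) (h : i + j + l ≤ n) :
    Set.EqOn (P.partialDeriv (P.partialDeriv u i j) k l) (P.partialDeriv u (k + i) (j + l))
      P.domain := by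
  refine (dx_iterate_congr (dy_iterate_partialDeriv hl hu h) k).trans ?_
  intro p _
  simp [partialDeriv, Function.iterate_add_apply]

lemma hasDerivWithinAt_partialDeriv_x (hl : 0 < P.len) {n i j : ℕ}
    (hu : ContDiffOn ℝ n u P.domain) (h : i + j + 1 ≤ n) (hp : p ∈ P.domain) :
    HasDerivWithinAt (fun s => P.partialDeriv u i j (s, p.2)) (P.partialDeriv u (i + 1) j p)
      P.xInterval p.1 := by
  rw [← dx_partialDeriv]
  exact hasDerivWithinAt_dx hl
    ((contDiffOn_partialDeriv (m := 1) hl hu h).differentiableOn_of_succ (m := 0) p hp) hp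

lemma hasDerivWithinAt_partialDeriv_y (hl : 0 < P.len) {n i j : ℕ}
    (hu : ContDiffOn ℝ n u P.domain) (h : i + j + 1 ≤ n) (hp : p ∈ P.domain) :
    HasDerivWithinAt (fun t => P.partialDeriv u i j (p.1, t)) (P.partialDeriv u i (j + 1) p)
      P.yInterval p.2 := by
  rw [← dy_partialDeriv hl hu h hp]
  exact hasDerivWithinAt_dy hl
    ((contDiffOn_partialDeriv (m := 1) hl hu h).differentiableOn_of_succ (m := 0) p hp) hp

/-- All partial derivatives of order `m` are bounded by `M` on `S`. -/
def DerivLE (P : FluxProblem) (u : ℝ × ℝ → ℝ) (m : ℕ) (S : Set (ℝ × ℝ)) (M : ℝ) : Prop :=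
  ∀ p ∈ S, ∀ i j : ℕ, i + j = m → |P.partialDeriv u i j p| ≤ M

lemma bddAbove_partialDeriv (hl : 0 < P.len) {n m : ℕ} (hu : ContDiffOn ℝ n u P.domain)
    (h : m ≤ n) :
    ∃ M, P.DerivLE u m P.domain M := by
  have : ∀ i : ℕ, ∃ C, ∀ p ∈ P.domain, i ≤ m → |P.partialDeriv u i (m - i) p| ≤ C := by
    intro i
    by_cases hi : i ≤ m
    · obtain ⟨C, hC⟩ := isCompact_domain.exists_bound_of_continuousOn
        (contDiffOn_partialDeriv (m := 0) (i := i) (j := m - i) hl hu (by omega)).continuousOn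
      exact ⟨C, fun p hp _ => hC p hp⟩
    · exact ⟨0, fun p _ h => absurd h hi⟩
  choose C hC using this
  refine ⟨∑ i ∈ Finset.range (m + 1), |C i|, fun p hp i j hij => ?_⟩
  obtain rfl : j = m - i := by omega
  refine (hC i p hp (by omega)).trans ((le_abs_self _).trans ?_)
  exact Finset.single_le_sum (f := fun i => |C i|) (fun _ _ => abs_nonneg _)
    (Finset.mem_range.2 (by omega))

lemma bdry_subset_domain : P.bdry ⊆ P.domain := fun _ hp => hp.1

/-- A real `sSup` of an unbounded set is 0, so `supDeriv` is an upper bound only because compactness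
of the square makes the set bounded. -/
lemma derivLE_supDeriv (hl : 0 < P.len) {n m : ℕ} (hu : ContDiffOn ℝ n u P.domain)
    (h : m ≤ n) {S : Set (ℝ × ℝ)} (hS : S ⊆ P.domain) :
    P.DerivLE u m S (P.supDeriv m u S) := by
  intro p hp i j hij
  refine le_csSup ?_ ⟨p, hp, i, j, hij, rfl⟩
  obtain ⟨M, hM⟩ := bddAbove_partialDeriv hl hu h
  refine ⟨M, ?_⟩
  rintro r ⟨q, hq, i, j, hij, rfl⟩
  exact hM q (hS hq) i j hij

lemma supDeriv_nonneg {m : ℕ} {S : Set (ℝ × ℝ)} : 0 ≤ P.supDeriv m u S :=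
  Real.sSup_nonneg (by rintro r ⟨q, hq, i, j, hij, rfl⟩; exact abs_nonneg _)

end PartialDerivatives

end FluxProblem

/-! ### Taylor expansions -/

/-- Taylor's formula with a crude remainder bound, for a chain of derivatives on a convex set. -/
lemma abs_sub_taylor_le {I : Set ℝ} (hI : Convex ℝ I) {x₀ x : ℝ} (hx₀ : x₀ ∈ I) (hx : x ∈ I)
    {M : ℝ} (n : ℕ) (φ : ℕ → ℝ → ℝ)
    (hφ : ∀ i < n, ∀ t ∈ I, HasDerivWithinAt (φ i) (φ (i + 1) t) I t)
    (hM : ∀ t ∈ I, |φ n t| ≤ M) :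
    |φ 0 x - ∑ i ∈ Finset.range n, φ i x₀ * (x - x₀) ^ i / i.factorial| ≤ M * |x - x₀| ^ n := by
  induction n generalizing φ x with
  | zero => simpa using hM x hx
  | succ n ih =>
    have hM0 : 0 ≤ M := (abs_nonneg _).trans (hM x hx)
    -- On the segment |t - x₀| ≤ |x - x₀|, so the induction hypothesis bounds the derivative of the
    -- remainder uniformly, and the mean value inequality supplies the missing factor.
    set S : Set ℝ := segment ℝ x₀ x with hS
    have hSI : S ⊆ I := hI.segment_subset hx₀ hx
    set T : ℝ → ℝ := fun t => φ 0 t - ∑ i ∈ Finset.range (n + 1), φ i x₀ * (t - x₀) ^ i / i.factorial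
    have hT : ∀ t ∈ S, HasDerivWithinAt T
        (φ 1 t - ∑ i ∈ Finset.range n, φ (i + 1) x₀ * (t - x₀) ^ i / i.factorial) S t := by
      intro t ht
      refine ((hφ 0 (Nat.succ_pos n) t (hSI ht)).mono hSI).sub ?_
      have h1 : ∀ i ∈ Finset.range (n + 1), HasDerivWithinAt
          (fun t : ℝ => φ i x₀ * (t - x₀) ^ i / i.factorial)
          (φ i x₀ * (i * (t - x₀) ^ (i - 1)) / i.factorial) S t := by
        intro i _
        have := ((hasDerivWithinAt_id t S).sub_const x₀).pow i
        simpa using (this.const_mul (φ i x₀)).div_const (i.factorial : ℝ)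
      refine (HasDerivWithinAt.fun_sum h1).congr_deriv ?_
      rw [Finset.sum_range_succ']
      simp only [Nat.cast_zero, zero_mul, mul_zero, zero_div, add_zero]
      refine Finset.sum_congr rfl fun i _ => ?_
      rw [Nat.factorial_succ, Nat.add_sub_cancel]
      have : ((i + 1 : ℕ) : ℝ) ≠ 0 := by positivity
      have : (i.factorial : ℝ) ≠ 0 := by positivity
      push_cast at *
      field_simp
    have hb : ∀ t ∈ S, ‖φ 1 t - ∑ i ∈ Finset.range n, φ (i + 1) x₀ * (t - x₀) ^ i / i.factorial‖
        ≤ M * |x - x₀| ^ n := by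
      intro t ht
      have h2 := ih (hSI ht) (fun i => φ (i + 1)) (fun i hi => hφ (i + 1) (by omega)) hM
      refine h2.trans ?_
      have h3 : |t - x₀| ≤ |x - x₀| := by
        rw [hS, segment_eq_uIcc] at ht
        exact Set.abs_sub_left_of_mem_uIcc ht
      gcongr
    have h4 := (convex_segment x₀ x).norm_image_sub_le_of_norm_hasDerivWithin_le hT hb
      (left_mem_segment ℝ x₀ x) (right_mem_segment ℝ x₀ x)
    have h5 : T x₀ = 0 := by
      simp [T, Finset.sum_range_succ']
    rw [h5, sub_zero, Real.norm_eq_abs, Real.norm_eq_abs, mul_assoc, ← pow_succ] at h4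
    exact h4

namespace FluxProblem

section Taylor

variable {P : FluxProblem} {u : ℝ × ℝ → ℝ} {p : ℝ × ℝ}

/-- The value at `(a, b)` of the Taylor polynomial of degree less than `n` with coefficients `c`. -/
noncomputable def taylorPoly (c : ℕ → ℕ → ℝ) (n : ℕ) (a b : ℝ) : ℝ :=
  ∑ j ∈ Finset.range n, ∑ i ∈ Finset.range (n - j),
    c i j * a ^ i / i.factorial * b ^ j / j.factorial

/-- Expand in y along the vertical line through the target, then expand the j-th coefficient in x to
degree n - j. Each of these n + 1 one-dimensional expansions stays in the square and costs at most M
rⁿ. -/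
lemma abs_sub_taylorPoly_le (hl : 0 < P.len) {n : ℕ} (hu : ContDiffOn ℝ n u P.domain) {M r : ℝ}
    (hM : P.DerivLE u n P.domain M) (hp : p ∈ P.domain) {a b : ℝ}
    (hq : (p.1 + a, p.2 + b) ∈ P.domain) (ha : |a| ≤ r) (hb : |b| ≤ r) :
    |u (p.1 + a, p.2 + b) - taylorPoly (fun i j => P.partialDeriv u i j p) n a b|
      ≤ (n + 1) * M * r ^ n := by
  have hM0 : 0 ≤ M := (abs_nonneg _).trans (hM p hp n 0 rfl)
  have hr : 0 ≤ r := (abs_nonneg a).trans ha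
  have hp' : (p.1 + a, p.2) ∈ P.domain := ⟨hq.1, hp.2⟩
  have h1 : |u (p.1 + a, p.2 + b) - ∑ j ∈ Finset.range n,
      P.partialDeriv u 0 j (p.1 + a, p.2) * b ^ j / j.factorial| ≤ M * r ^ n := by
    have := abs_sub_taylor_le (convex_Icc _ _ : Convex ℝ P.yInterval) hp.2 hq.2 n
      (fun j t => P.partialDeriv u 0 j (p.1 + a, t))
      (fun j hj t ht => hasDerivWithinAt_partialDeriv_y (p := (p.1 + a, t)) hl hu (by omega)
        ⟨hq.1, ht⟩) (fun t ht => hM (p.1 + a, t) ⟨hq.1, ht⟩ 0 n (zero_add n))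
    simp only [add_sub_cancel_left] at this
    exact this.trans (by gcongr)
  have h2 : ∀ j ∈ Finset.range n, |P.partialDeriv u 0 j (p.1 + a, p.2) * b ^ j / j.factorial
      - ∑ i ∈ Finset.range (n - j),
        P.partialDeriv u i j p * a ^ i / i.factorial * b ^ j / j.factorial| ≤ M * r ^ n := by
    intro j hj
    have hj' := Finset.mem_range.1 hj
    have := abs_sub_taylor_le (convex_Icc _ _ : Convex ℝ P.xInterval) hp.1 hq.1 (n - j)
      (fun i s => P.partialDeriv u i j (s, p.2))
      (fun i hi s hs => hasDerivWithinAt_partialDeriv_x (p := (s, p.2)) hl hu (by omega)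
        ⟨hs, hp.2⟩) (fun s hs => hM (s, p.2) ⟨hs, hp.2⟩ (n - j) j (by omega))
    simp only [add_sub_cancel_left] at this
    have hfac : (1 : ℝ) ≤ j.factorial := by exact_mod_cast Nat.succ_le_of_lt j.factorial_pos
    simp only [mul_div_assoc, ← Finset.sum_mul] at this ⊢
    rw [← sub_mul, abs_mul]
    calc _ ≤ (M * |a| ^ (n - j)) * |b ^ j / j.factorial| := by gcongr
      _ ≤ (M * r ^ (n - j)) * r ^ j := by
        gcongr
        rw [abs_div, abs_pow, Nat.abs_cast]
        exact (div_le_self (by positivity) hfac).trans (by gcongr)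
      _ = M * r ^ n := by rw [mul_assoc, ← pow_add, Nat.sub_add_cancel hj'.le]
  have h3 := Finset.sum_le_sum h2
  rw [Finset.sum_const, Finset.card_range, nsmul_eq_mul] at h3
  have h4 := (Finset.abs_sum_le_sum_abs _ _).trans h3
  rw [Finset.sum_sub_distrib] at h4
  calc _ ≤ _ := abs_sub_le _ (∑ j ∈ Finset.range n,
        P.partialDeriv u 0 j (p.1 + a, p.2) * b ^ j / j.factorial) _
    _ ≤ M * r ^ n + n * (M * r ^ n) := add_le_add h1 h4
    _ = _ := by ring

end Taylor

/-! ### Consistency of the scheme -/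

/-- Coefficients of the Laplacian in terms of the Taylor coefficients. -/
def lapJet (c : ℕ → ℕ → ℝ) (i j : ℕ) : ℝ := c (i + 2) j + c i (j + 2)

/-- This exchange of coordinates and the reflection in `taylorPoly_pow_mul` with ε = -1 reduce all
four sides to a single computation. -/
lemma taylorPoly_swap (c : ℕ → ℕ → ℝ) (n : ℕ) (a b : ℝ) :
    taylorPoly (fun i j => c j i) n a b = taylorPoly c n b a := by
  unfold taylorPoly
  rw [Finset.sum_comm' (t' := Finset.range n) (s' := fun i => Finset.range (n - i))]
  · refine Finset.sum_congr rfl fun i _ => Finset.sum_congr rfl fun j _ => ?_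
    ring
  · intro i j
    simp only [Finset.mem_range]
    omega

lemma taylorPoly_pow_mul (c : ℕ → ℕ → ℝ) (n : ℕ) (ε a b : ℝ) :
    taylorPoly (fun i j => ε ^ i * c i j) n a b = taylorPoly c n (ε * a) b := by
  unfold taylorPoly
  refine Finset.sum_congr rfl fun i _ => Finset.sum_congr rfl fun j _ => ?_
  rw [mul_pow]; ring

lemma taylorPoly_add (c d : ℕ → ℕ → ℝ) (n : ℕ) (a b : ℝ) :
    taylorPoly (fun i j => c i j + d i j) n a b = taylorPoly c n a b + taylorPoly d n a b := by
  unfold taylorPoly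
  simp only [← Finset.sum_add_distrib]
  refine Finset.sum_congr rfl fun i _ => Finset.sum_congr rfl fun j _ => ?_
  ring

/-- The nine-point formula, for values given by Taylor expansions up to an error. -/
lemma abs_ninePoint_le {c : ℕ → ℕ → ℝ} {h M : ℝ} (hh : 0 < h) {v G : ℤ → ℤ → ℝ}
    (hv : ∀ a b : ℤ, |a| ≤ 1 → |b| ≤ 1 →
      |v a b - taylorPoly c 6 (a * h) (b * h)| ≤ 7 * M * h ^ 6)
    (hG : ∀ a b : ℤ, |a| ≤ 1 → |b| ≤ 1 →
      |G a b - taylorPoly (lapJet c) 4 (a * h) (b * h)| ≤ 10 * M * h ^ 4)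
    (hv0 : v 0 0 = c 0 0) (hG0 : G 0 0 = lapJet c 0 0) :
    |1 / (6 * h ^ 2) * (v 1 1 + v 1 (-1) + v (-1) 1 + v (-1) (-1)
      + 4 * (v 1 0 + v (-1) 0 + v 0 1 + v 0 (-1)) - 20 * v 0 0)
      - 1 / 12 * (G (-1) 0 + G 1 0 + G 0 (-1) + G 0 1 + 8 * G 0 0)| ≤ 27 * M * h ^ 4 := by
  have e1 := hv 1 1 (by norm_num) (by norm_num)
  have e2 := hv 1 (-1) (by norm_num) (by norm_num)
  have e3 := hv (-1) 1 (by norm_num) (by norm_num)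
  have e4 := hv (-1) (-1) (by norm_num) (by norm_num)
  have e5 := hv 1 0 (by norm_num) (by norm_num)
  have e6 := hv (-1) 0 (by norm_num) (by norm_num)
  have e7 := hv 0 1 (by norm_num) (by norm_num)
  have e8 := hv 0 (-1) (by norm_num) (by norm_num)
  have g1 := hG 1 0 (by norm_num) (by norm_num)
  have g2 := hG (-1) 0 (by norm_num) (by norm_num)
  have g3 := hG 0 1 (by norm_num) (by norm_num)
  have g4 := hG 0 (-1) (by norm_num) (by norm_num)
  push_cast at e1 e2 e3 e4 e5 e6 e7 e8 g1 g2 g3 g4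
  have hM : 0 ≤ M * h ^ 4 := by
    have := (abs_nonneg _).trans g1
    linarith
  rw [hv0, hG0]
  clear hv hG hv0 hG0
  have h6 : M * h ^ 6 = h ^ 2 * (M * h ^ 4) := by ring
  set m := M * h ^ 4 with hm
  -- On the Taylor polynomials the two stencils agree exactly, so only remainders survive; their
  -- weights give 20·7/6 + 4·10/12 < 27.
  have key : h ^ 2 * (1 / (6 * h ^ 2) * (v 1 1 + v 1 (-1) + v (-1) 1 + v (-1) (-1)
      + 4 * (v 1 0 + v (-1) 0 + v 0 1 + v 0 (-1)) - 20 * c 0 0)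
      - 1 / 12 * (G (-1) 0 + G 1 0 + G 0 (-1) + G 0 1 + 8 * lapJet c 0 0)) =
      1 / 6 * ((v 1 1 - taylorPoly c 6 (1 * h) (1 * h)) + (v 1 (-1) - taylorPoly c 6 (1 * h) (-1 * h))
      + (v (-1) 1 - taylorPoly c 6 (-1 * h) (1 * h))
      + (v (-1) (-1) - taylorPoly c 6 (-1 * h) (-1 * h))
      + 4 * ((v 1 0 - taylorPoly c 6 (1 * h) (0 * h)) + (v (-1) 0 - taylorPoly c 6 (-1 * h) (0 * h))
      + (v 0 1 - taylorPoly c 6 (0 * h) (1 * h)) + (v 0 (-1) - taylorPoly c 6 (0 * h) (-1 * h))))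
      - 1 / 12 * (h ^ 2 * (G (-1) 0 - taylorPoly (lapJet c) 4 (-1 * h) (0 * h))
      + h ^ 2 * (G 1 0 - taylorPoly (lapJet c) 4 (1 * h) (0 * h))
      + h ^ 2 * (G 0 (-1) - taylorPoly (lapJet c) 4 (0 * h) (-1 * h))
      + h ^ 2 * (G 0 1 - taylorPoly (lapJet c) 4 (0 * h) (1 * h))) := by
    have : h ^ 2 * (1 / (6 * h ^ 2)) = 1 / 6 := by field_simp
    rw [mul_sub, ← mul_assoc, this]
    simp [taylorPoly, lapJet, Finset.sum_range_succ, Nat.factorial]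
    ring
  have hh2 : 0 < h ^ 2 := by positivity
  have G' : ∀ x : ℝ, |x| ≤ 10 * M * h ^ 4 → |h ^ 2 * x| ≤ 10 * (h ^ 2 * m) := by
    intro x hx
    rw [abs_mul, abs_of_pos hh2]
    nlinarith
  have g1 := G' _ g1
  have g2 := G' _ g2
  have g3 := G' _ g3
  have g4 := G' _ g4
  rw [mul_assoc, h6, abs_le] at e1 e2 e3 e4 e5 e6 e7 e8
  rw [abs_le] at g1 g2 g3 g4
  refine le_of_mul_le_mul_left ?_ hh2
  rw [← abs_of_pos hh2, ← abs_mul, abs_of_pos hh2, key, mul_assoc, ← hm, abs_le]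
  have hpos : 0 ≤ h ^ 2 * m := by positivity
  constructor
  · linarith [e1.1, e2.1, e3.1, e4.1, e5.1, e6.1, e7.1, e8.1, g1.2, g2.2, g3.2, g4.2]
  · linarith [e1.2, e2.2, e3.2, e4.2, e5.2, e6.2, e7.2, e8.2, g1.1, g2.1, g3.1, g4.1]

/-- The flux formula without the terms containing `K`: the coefficients `c i j` belong to `i`
inward normal and `j` tangential derivatives. -/
lemma abs_sixPoint_le {c : ℕ → ℕ → ℝ} {h M v₁ v₂ w₀ w₁ w₂ g₁ g₂ G₁ G₂ : ℝ} (hh : 0 < h)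
    (e1 : |v₁ - taylorPoly c 5 (0 * h) (1 * h)| ≤ 192 * M * h ^ 5)
    (e2 : |v₂ - taylorPoly c 5 (0 * h) (-1 * h)| ≤ 192 * M * h ^ 5)
    (e3 : |w₀ - taylorPoly c 5 (1 * h) (0 * h)| ≤ 192 * M * h ^ 5)
    (e4 : |w₁ - taylorPoly c 5 (1 * h) (1 * h)| ≤ 192 * M * h ^ 5)
    (e5 : |w₂ - taylorPoly c 5 (1 * h) (-1 * h)| ≤ 192 * M * h ^ 5)
    (d1 : |g₁ - taylorPoly (lapJet c) 3 (0 * h) (1 * h)| ≤ 64 * M * h ^ 3)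
    (d2 : |g₂ - taylorPoly (lapJet c) 3 (0 * h) (-1 * h)| ≤ 64 * M * h ^ 3)
    (d3 : |G₁ - taylorPoly (lapJet c) 3 (1 * h) (0 * h)| ≤ 64 * M * h ^ 3)
    (d4 : |G₂ - taylorPoly (lapJet c) 3 (2 * h) (0 * h)| ≤ 64 * M * h ^ 3) :
    |8 * v₁ + 8 * v₂ + 4 * w₁ + 4 * w₂ + 16 * w₀ - 40 * c 0 0
      - h ^ 2 * (g₁ + g₂ - (3 * lapJet c 0 0 - 3 * G₁ + G₂) + 8 * lapJet c 0 0 + 3 * G₁)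
      - 24 * h * c 1 0| ≤ 8256 * M * h ^ 5 := by
  have hM : 0 ≤ M * h ^ 3 := by
    have := (abs_nonneg _).trans d1
    linarith
  -- Again the Taylor polynomials cancel exactly, the normal slope being taken up by 24 h c₁₀. The
  -- remainders have total weight 40 for u and 9 for Δu, and 40·192 + 9·64 = 8256.
  have key : 8 * v₁ + 8 * v₂ + 4 * w₁ + 4 * w₂ + 16 * w₀ - 40 * c 0 0
      - h ^ 2 * (g₁ + g₂ - (3 * lapJet c 0 0 - 3 * G₁ + G₂) + 8 * lapJet c 0 0 + 3 * G₁)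
      - 24 * h * c 1 0
      = 8 * (v₁ - taylorPoly c 5 (0 * h) (1 * h)) + 8 * (v₂ - taylorPoly c 5 (0 * h) (-1 * h))
      + 4 * (w₁ - taylorPoly c 5 (1 * h) (1 * h)) + 4 * (w₂ - taylorPoly c 5 (1 * h) (-1 * h))
      + 16 * (w₀ - taylorPoly c 5 (1 * h) (0 * h))
      - (h ^ 2 * (g₁ - taylorPoly (lapJet c) 3 (0 * h) (1 * h))
      + h ^ 2 * (g₂ - taylorPoly (lapJet c) 3 (0 * h) (-1 * h))
      + 6 * (h ^ 2 * (G₁ - taylorPoly (lapJet c) 3 (1 * h) (0 * h)))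
      - h ^ 2 * (G₂ - taylorPoly (lapJet c) 3 (2 * h) (0 * h))) := by
    simp [taylorPoly, lapJet, Finset.sum_range_succ, Nat.factorial]
    ring
  have hh2 : 0 < h ^ 2 := by positivity
  have h6 : M * h ^ 5 = h ^ 2 * (M * h ^ 3) := by ring
  set m := M * h ^ 3 with hm
  have G' : ∀ x : ℝ, |x| ≤ 64 * M * h ^ 3 → |h ^ 2 * x| ≤ 64 * (h ^ 2 * m) := by
    intro x hx
    rw [abs_mul, abs_of_pos hh2]
    nlinarith
  have d1 := G' _ d1
  have d2 := G' _ d2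
  have d3 := G' _ d3
  have d4 := G' _ d4
  rw [mul_assoc, h6, abs_le] at e1 e2 e3 e4 e5
  rw [abs_le] at d1 d2 d3 d4
  rw [key, mul_assoc, h6, abs_le]
  constructor
  · linarith [e1.1, e2.1, e3.1, e4.1, e5.1, d1.2, d2.2, d3.2, d4.1]
  · linarith [e1.2, e2.2, e3.2, e4.2, e5.2, d1.1, d2.1, d3.1, d4.2]

/-- The terms containing `K` in the flux formula. -/
lemma abs_sixPoint_lowerOrder_le {c : ℕ → ℕ → ℝ} {h M v₁ v₂ w₀ z : ℝ}
    (e1 : |v₁ - taylorPoly c 3 (0 * h) (1 * h)| ≤ 32 * M * h ^ 3)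
    (e2 : |v₂ - taylorPoly c 3 (0 * h) (-1 * h)| ≤ 32 * M * h ^ 3)
    (e3 : |w₀ - taylorPoly c 3 (1 * h) (0 * h)| ≤ 32 * M * h ^ 3)
    (e4 : |z - taylorPoly c 3 (2 * h) (0 * h)| ≤ 32 * M * h ^ 3) :
    |12 * c 0 0 - (v₁ + v₂ - (3 * c 0 0 - 3 * w₀ + z) + 8 * c 0 0 + 3 * w₀)
      + h ^ 2 * lapJet c 0 0 + 4 * h * c 1 0| ≤ 288 * M * h ^ 3 := by
  have key : 12 * c 0 0 - (v₁ + v₂ - (3 * c 0 0 - 3 * w₀ + z) + 8 * c 0 0 + 3 * w₀)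
      + h ^ 2 * lapJet c 0 0 + 4 * h * c 1 0
      = - (v₁ - taylorPoly c 3 (0 * h) (1 * h)) - (v₂ - taylorPoly c 3 (0 * h) (-1 * h))
      - 6 * (w₀ - taylorPoly c 3 (1 * h) (0 * h)) + (z - taylorPoly c 3 (2 * h) (0 * h)) := by
    simp [taylorPoly, lapJet, Finset.sum_range_succ, Nat.factorial]
    ring
  rw [key, abs_le]
  rw [abs_le] at e1 e2 e3 e4
  constructor
  · linarith [e1.2, e2.2, e3.2, e4.1]
  · linarith [e1.1, e2.1, e3.1, e4.2]

/-! ### Residuals of the scheme at interior and flux grid points -/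

section Grid

variable {P : FluxProblem} {u f : ℝ × ℝ → ℝ} {N : ℕ} {k l : ℤ × ℤ}

lemma h_pos (hl : 0 < P.len) (hN : 1 ≤ N) : 0 < P.h N :=
  div_pos hl (by exact_mod_cast hN)

lemma cast_mul_h (hN : 1 ≤ N) : (N : ℝ) * P.h N = P.len := by
  have : (N : ℝ) ≠ 0 := by positivity
  unfold h; field_simp

lemma node_mem_domain (hl : 0 < P.len) (hN : 1 ≤ N) (hk : k ∈ grid N) :
    P.node N k ∈ P.domain := by
  obtain ⟨h1, h2, h3, h4⟩ := hk
  have hh := h_pos hl hN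
  have h1' : (0 : ℝ) ≤ k.1 := by exact_mod_cast h1
  have h2' : (k.1 : ℝ) ≤ N := by exact_mod_cast h2
  have h3' : (0 : ℝ) ≤ k.2 := by exact_mod_cast h3
  have h4' : (k.2 : ℝ) ≤ N := by exact_mod_cast h4
  have := cast_mul_h (P := P) hN
  refine ⟨⟨?_, ?_⟩, ⟨?_, ?_⟩⟩ <;> simp only [node] <;> nlinarith

lemma node_eq (N : ℕ) (k l : ℤ × ℤ) : P.node N l =
    ((P.node N k).1 + (l.1 - k.1) * P.h N, (P.node N k).2 + (l.2 - k.2) * P.h N) := by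
  ext <;> simp only [node] <;> ring

lemma laplacian_eq (u : ℝ × ℝ → ℝ) (p : ℝ × ℝ) :
    P.laplacian u p = P.partialDeriv u 2 0 p + P.partialDeriv u 0 2 p := rfl

lemma derivLE_partialDeriv (hl : 0 < P.len) {n i j : ℕ} {M : ℝ}
    (hu : ContDiffOn ℝ (n + (i + j) : ℕ) u P.domain)
    (hM : P.DerivLE u (n + (i + j)) P.domain M) :
    P.DerivLE (P.partialDeriv u i j) n P.domain M := by
  intro p hp a b hab
  rw [partialDeriv_partialDeriv hl hu (by omega) hp]
  exact hM p hp _ _ (by omega)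

/-- The jets of the two pure second derivatives are shifted jets of u, because partial derivatives
commute; expanding each separately explains the factor 2. -/
lemma abs_laplacian_sub_taylorPoly_le (hl : 0 < P.len) {n : ℕ}
    (hu : ContDiffOn ℝ (n + 2 : ℕ) u P.domain) {M r : ℝ}
    (hM : P.DerivLE u (n + 2) P.domain M) {p : ℝ × ℝ} (hp : p ∈ P.domain) {a b : ℝ}
    (hq : (p.1 + a, p.2 + b) ∈ P.domain) (ha : |a| ≤ r) (hb : |b| ≤ r) :
    |P.laplacian u (p.1 + a, p.2 + b)
      - taylorPoly (lapJet fun i j => P.partialDeriv u i j p) n a b|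
      ≤ 2 * ((n + 1) * M * r ^ n) := by
  have h1 := abs_sub_taylorPoly_le hl (contDiffOn_partialDeriv (i := 2) (j := 0) hl hu (by omega))
    (derivLE_partialDeriv (i := 2) (j := 0) hl hu hM) hp hq ha hb
  have h2 := abs_sub_taylorPoly_le hl (contDiffOn_partialDeriv (i := 0) (j := 2) hl hu (by omega))
    (derivLE_partialDeriv (i := 0) (j := 2) hl hu hM) hp hq ha hb
  have h3 : taylorPoly (lapJet fun i j => P.partialDeriv u i j p) n a b
      = taylorPoly (fun i j => P.partialDeriv (P.partialDeriv u 2 0) i j p) n a b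
      + taylorPoly (fun i j => P.partialDeriv (P.partialDeriv u 0 2) i j p) n a b := by
    rw [← taylorPoly_add]
    unfold taylorPoly
    refine Finset.sum_congr rfl fun j hj => Finset.sum_congr rfl fun i hi => ?_
    have hj' := Finset.mem_range.1 hj
    beta_reduce
    rw [partialDeriv_partialDeriv (i := 2) hl hu (by omega) hp,
      partialDeriv_partialDeriv (i := 0) hl hu (by omega) hp]
    simp only [lapJet, add_zero, add_comm]
  rw [laplacian_eq, h3, add_sub_add_comm]
  exact (abs_add_le _ _).trans (by linarith)

/-- Consistency of the nine-point scheme at the interior grid points. -/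
lemma abs_Lh_sub_Mh_laplacian_le (hl : 0 < P.len) (hN : 1 ≤ N)
    (hu : ContDiffOn ℝ (6 : ℕ) u P.domain) {M : ℝ} (hM : P.DerivLE u 6 P.domain M)
    (hk : k ∈ interiorGrid N) :
    |P.Lh N (u ∘ P.node N) k - Mh (P.laplacian u ∘ P.node N) k| ≤ 27 * M * P.h N ^ 4 := by
  have hh := h_pos hl hN
  obtain ⟨h1, h2, h3, h4⟩ := hk
  have hkg : k ∈ grid N := ⟨h1.le, h2.le, h3.le, h4.le⟩
  have hp := node_mem_domain (P := P) hl hN hkg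
  set p := P.node N k with hpdef
  have hnode : ∀ a b : ℤ, P.node N (k + (a, b)) = (p.1 + a * P.h N, p.2 + b * P.h N) := by
    intro a b
    rw [node_eq N k]; simp [hpdef]
  have hmem : ∀ a b : ℤ, |a| ≤ 1 → |b| ≤ 1 → k + (a, b) ∈ grid N := by
    intro a b ha hb
    rw [abs_le] at ha hb
    refine ⟨?_, ?_, ?_, ?_⟩ <;> simp <;> omega
  have hsc : ∀ a : ℤ, |a| ≤ 1 → |(a : ℝ) * P.h N| ≤ P.h N := by
    intro a ha
    have : |(a : ℝ)| ≤ 1 := by exact_mod_cast ha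
    rw [abs_mul, abs_of_pos hh]; nlinarith
  have hV : ∀ a b : ℤ, |a| ≤ 1 → |b| ≤ 1 → |(u ∘ P.node N) (k + (a, b))
      - taylorPoly (fun i j => P.partialDeriv u i j p) 6 (a * P.h N) (b * P.h N)|
      ≤ 7 * M * P.h N ^ 6 := by
    intro a b ha hb
    have hq := node_mem_domain (P := P) hl hN (hmem a b ha hb)
    rw [hnode] at hq
    have := abs_sub_taylorPoly_le hl hu hM hp hq (hsc a ha) (hsc b hb)
    rw [Function.comp, hnode]
    convert this using 1
    norm_num
  have hG : ∀ a b : ℤ, |a| ≤ 1 → |b| ≤ 1 → |(P.laplacian u ∘ P.node N) (k + (a, b))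
      - taylorPoly (lapJet fun i j => P.partialDeriv u i j p) 4 (a * P.h N) (b * P.h N)|
      ≤ 10 * M * P.h N ^ 4 := by
    intro a b ha hb
    have hq := node_mem_domain (P := P) hl hN (hmem a b ha hb)
    rw [hnode] at hq
    have := abs_laplacian_sub_taylorPoly_le (n := 4) hl hu hM hp hq (hsc a ha) (hsc b hb)
    rw [Function.comp, hnode]
    convert this using 1
    norm_num; ring
  have h0 : k + (0, 0) = k := by simp
  have := abs_ninePoint_le hh hV hG (by rw [h0]; rfl) (by rw [h0]; rfl)
  rw [h0] at this
  exact this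

/-- The Taylor coefficients at a point of a side, where `i` counts the inward normal and `j` the
tangential derivatives. -/
noncomputable def sideJet (P : FluxProblem) (s : SquareSide) (u : ℝ × ℝ → ℝ) (p : ℝ × ℝ)
    (i j : ℕ) : ℝ :=
  match s with
  | .left => 1 ^ i * P.partialDeriv u i j p
  | .right => (-1) ^ i * P.partialDeriv u i j p
  | .bottom => 1 ^ i * P.partialDeriv u j i p
  | .top => (-1) ^ i * P.partialDeriv u j i p

/-- The signs and swaps in `sideJet` make a and b the steps along the inward normal and the tangent,
so the flux formula is checked once for all sides. -/
lemma taylorPoly_sideJet (s : SquareSide) (u : ℝ × ℝ → ℝ) (p : ℝ × ℝ) (n : ℕ) (a b : ℝ) :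
    taylorPoly (P.sideJet s u p) n a b = taylorPoly (fun i j => P.partialDeriv u i j p) n
      (a * s.inward.1 + b * s.tangent.1) (a * s.inward.2 + b * s.tangent.2) := by
  cases s
  · change taylorPoly (fun i j => 1 ^ i * P.partialDeriv u i j p) n a b = _
    rw [taylorPoly_pow_mul]; simp [SquareSide.inward, SquareSide.tangent]
  · change taylorPoly (fun i j => (-1) ^ i * P.partialDeriv u i j p) n a b = _
    rw [taylorPoly_pow_mul]; simp [SquareSide.inward, SquareSide.tangent]
  · change taylorPoly (fun i j => 1 ^ i * P.partialDeriv u j i p) n a b = _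
    rw [taylorPoly_pow_mul, taylorPoly_swap (fun i j => P.partialDeriv u i j p)]
    simp [SquareSide.inward, SquareSide.tangent]
  · change taylorPoly (fun i j => (-1) ^ i * P.partialDeriv u j i p) n a b = _
    rw [taylorPoly_pow_mul, taylorPoly_swap (fun i j => P.partialDeriv u i j p)]
    simp [SquareSide.inward, SquareSide.tangent]

lemma taylorPoly_lapJet_sideJet (s : SquareSide) (u : ℝ × ℝ → ℝ) (p : ℝ × ℝ) (n : ℕ) (a b : ℝ) :
    taylorPoly (lapJet (P.sideJet s u p)) n a b
      = taylorPoly (lapJet fun i j => P.partialDeriv u i j p) n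
      (a * s.inward.1 + b * s.tangent.1) (a * s.inward.2 + b * s.tangent.2) := by
  have hL : ∀ i j, lapJet (P.sideJet .left u p) i j =
      1 ^ i * lapJet (fun i j => P.partialDeriv u i j p) i j := by
    intro i j; simp only [lapJet, sideJet]; ring
  have hR : ∀ i j, lapJet (P.sideJet .right u p) i j =
      (-1) ^ i * lapJet (fun i j => P.partialDeriv u i j p) i j := by
    intro i j; simp only [lapJet, sideJet]; ring
  have hB : ∀ i j, lapJet (P.sideJet .bottom u p) i j =
      1 ^ i * lapJet (fun i j => P.partialDeriv u i j p) j i := by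
    intro i j; simp only [lapJet, sideJet]; ring
  have hT : ∀ i j, lapJet (P.sideJet .top u p) i j =
      (-1) ^ i * lapJet (fun i j => P.partialDeriv u i j p) j i := by
    intro i j; simp only [lapJet, sideJet]; ring
  cases s
  · rw [funext₂ hL, taylorPoly_pow_mul]; simp [SquareSide.inward, SquareSide.tangent]
  · rw [funext₂ hR, taylorPoly_pow_mul]; simp [SquareSide.inward, SquareSide.tangent]
  · rw [funext₂ hB, taylorPoly_pow_mul, taylorPoly_swap (lapJet _)]
    simp [SquareSide.inward, SquareSide.tangent]
  · rw [funext₂ hT, taylorPoly_pow_mul, taylorPoly_swap (lapJet _)]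
    simp [SquareSide.inward, SquareSide.tangent]

lemma sideJet_zero (s : SquareSide) (u : ℝ × ℝ → ℝ) (p : ℝ × ℝ) : P.sideJet s u p 0 0 = u p := by
  cases s <;> simp [sideJet, partialDeriv]

lemma lapJet_sideJet_zero (s : SquareSide) (u : ℝ × ℝ → ℝ) (p : ℝ × ℝ) :
    lapJet (P.sideJet s u p) 0 0 = P.laplacian u p := by
  cases s <;> simp [sideJet, lapJet, laplacian_eq, add_comm]

lemma normalDeriv_eq_sideJet (s : SquareSide) (u : ℝ × ℝ → ℝ) (p : ℝ × ℝ) :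
    P.normalDeriv s u p = - P.sideJet s u p 1 0 := by
  cases s <;> simp [sideJet, normalDeriv, partialDeriv, SquareSide.inward]

lemma sideGrid_subset_grid (s : SquareSide) : sideGrid N s ⊆ grid N := by
  intro k hk
  cases s <;> obtain ⟨h1, h2, h3⟩ := hk <;> exact ⟨by omega, by omega, by omega, by omega⟩

/-- A side without its corners contains a grid point only if N ≥ 2, so two steps inwards, as the
quadratic extrapolation needs, never leave the grid. -/
lemma mem_grid_of_mem_sideGrid {s : SquareSide} (hk : k ∈ sideGrid N s) {a b : ℤ}
    (ha : 0 ≤ a) (ha2 : a ≤ 2) (hb : |b| ≤ 1) :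
    k + a • s.inward + b • s.tangent ∈ grid N := by
  rw [abs_le] at hb
  cases s <;> obtain ⟨h1, h2, h3⟩ := hk <;>
    refine ⟨?_, ?_, ?_, ?_⟩ <;> simp [SquareSide.inward, SquareSide.tangent] <;> omega

lemma node_side (s : SquareSide) (k : ℤ × ℤ) (a b : ℤ) :
    P.node N (k + a • s.inward + b • s.tangent) =
      ((P.node N k).1 + (a * P.h N * s.inward.1 + b * P.h N * s.tangent.1),
       (P.node N k).2 + (a * P.h N * s.inward.2 + b * P.h N * s.tangent.2)) := by
  rw [node_eq N k]
  ext <;> simp <;> ring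

lemma abs_side_offset_le (hh : 0 < P.h N) (s : SquareSide) {a b : ℤ} (ha : 0 ≤ a) (ha2 : a ≤ 2)
    (hb : |b| ≤ 1) :
    |(a * P.h N * s.inward.1 + b * P.h N * s.tangent.1 : ℝ)| ≤ 2 * P.h N ∧
    |(a * P.h N * s.inward.2 + b * P.h N * s.tangent.2 : ℝ)| ≤ 2 * P.h N := by
  have h1 : (0 : ℝ) ≤ a := by exact_mod_cast ha
  have h2 : (a : ℝ) ≤ 2 := by exact_mod_cast ha2
  have h3 : |(b : ℝ)| ≤ 1 := by exact_mod_cast hb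
  rw [abs_le] at h3
  simp only [abs_le]
  cases s <;> simp [SquareSide.inward, SquareSide.tangent] <;> refine ⟨⟨?_, ?_⟩, ⟨?_, ?_⟩⟩ <;>
    nlinarith

/-- The radius is 2h because the extrapolation uses the second grid line inside. It produces the
constants 192 = 6·2⁵ and 32 = 4·2³, and 64 = 2·4·2³ for the Laplacian. -/
lemma abs_side_sub_taylorPoly_le (hl : 0 < P.len) (hN : 1 ≤ N) {n : ℕ}
    (hu : ContDiffOn ℝ n u P.domain) {M : ℝ} (hM : P.DerivLE u n P.domain M) {s : SquareSide}
    (hk : k ∈ sideGrid N s) {a b : ℤ} (ha : 0 ≤ a) (ha2 : a ≤ 2) (hb : |b| ≤ 1)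
    (hlk : l = k + a • s.inward + b • s.tangent) :
    |u (P.node N l) - taylorPoly (P.sideJet s u (P.node N k)) n (a * P.h N) (b * P.h N)|
      ≤ (n + 1) * M * (2 * P.h N) ^ n := by
  have hq := node_mem_domain (P := P) hl hN (mem_grid_of_mem_sideGrid hk ha ha2 hb)
  have hb' := abs_side_offset_le (h_pos hl hN) s ha ha2 hb
  rw [taylorPoly_sideJet, hlk]
  rw [node_side] at hq ⊢
  exact abs_sub_taylorPoly_le hl hu hM (node_mem_domain hl hN (sideGrid_subset_grid s hk)) hq
    hb'.1 hb'.2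

lemma abs_side_laplacian_sub_taylorPoly_le (hl : 0 < P.len) (hN : 1 ≤ N) {n : ℕ}
    (hu : ContDiffOn ℝ (n + 2 : ℕ) u P.domain) {M : ℝ} (hM : P.DerivLE u (n + 2) P.domain M)
    {s : SquareSide} (hk : k ∈ sideGrid N s) {a b : ℤ} (ha : 0 ≤ a) (ha2 : a ≤ 2) (hb : |b| ≤ 1)
    (hlk : l = k + a • s.inward + b • s.tangent) :
    |P.laplacian u (P.node N l)
      - taylorPoly (lapJet (P.sideJet s u (P.node N k))) n (a * P.h N) (b * P.h N)|
      ≤ 2 * ((n + 1) * M * (2 * P.h N) ^ n) := by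
  have hq := node_mem_domain (P := P) hl hN (mem_grid_of_mem_sideGrid hk ha ha2 hb)
  have hb' := abs_side_offset_le (h_pos hl hN) s ha ha2 hb
  rw [taylorPoly_lapJet_sideJet, hlk]
  rw [node_side] at hq ⊢
  exact abs_laplacian_sub_taylorPoly_le hl hu hM
    (node_mem_domain hl hN (sideGrid_subset_grid s hk)) hq hb'.1 hb'.2

lemma twelve_le_lam (hK : P.K ≤ 0) (N : ℕ) : 12 ≤ P.lam N := by
  unfold lam; nlinarith [sq_nonneg (P.h N)]

/-- Dividing by l h² turns h⁵ into h³, and l ≥ 1 is enough. The constant 288 is enlarged to 8256 so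
that one constant serves both terms. -/
lemma abs_fluxResidual_le {l h K R X Y D M₅ M₃ δ : ℝ} (hh : 0 < h) (hl : 1 ≤ l) (hM : 0 ≤ M₃)
    (key : l * h ^ 2 * R = X + K * h ^ 2 * Y + h ^ 2 * D) (hX : |X| ≤ 8256 * M₅ * h ^ 5)
    (hY : |Y| ≤ 288 * M₃ * h ^ 3) (hD : |D| ≤ δ) :
    |R| ≤ 8256 * (M₅ + |K| * M₃) * h ^ 3 + δ := by
  have hh2 : 0 < h ^ 2 := by positivity
  have hKY : |K * h ^ 2 * Y| ≤ |K| * h ^ 2 * (8256 * M₃ * h ^ 3) := by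
    rw [abs_mul, abs_mul, abs_of_pos hh2]
    gcongr
    exact hY.trans (by gcongr; norm_num)
  have hhD : |h ^ 2 * D| ≤ h ^ 2 * δ := by
    rw [abs_mul, abs_of_pos hh2]; gcongr
  refine le_of_mul_le_mul_left (a := h ^ 2) ?_ hh2
  calc h ^ 2 * |R| ≤ l * (h ^ 2 * |R|) := le_mul_of_one_le_left (by positivity) hl
    _ = |l * h ^ 2 * R| := by
      rw [abs_mul, abs_mul, abs_of_pos hh2, abs_of_pos (by linarith : (0 : ℝ) < l), mul_assoc]
    _ ≤ |X| + |K * h ^ 2 * Y| + |h ^ 2 * D| := key ▸ abs_add_three _ _ _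
    _ ≤ 8256 * M₅ * h ^ 5 + |K| * h ^ 2 * (8256 * M₃ * h ^ 3) + h ^ 2 * δ := by gcongr
    _ = _ := by ring

set_option maxHeartbeats 800000 in
/-- Consistency of the flux formula. -/
lemma abs_fluxLhs_sub_fluxRhs_le (hl : 0 < P.len) (hK : P.K ≤ 0) (hN : 1 ≤ N)
    (hu : ContDiffOn ℝ (5 : ℕ) u P.domain) {M₅ M₃ δ : ℝ} (hM₅ : P.DerivLE u 5 P.domain M₅)
    (hM₃ : P.DerivLE u 3 P.domain M₃) {s : SquareSide} (hk : k ∈ sideGrid N s)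
    {F : ℤ × ℤ → ℝ} {g : ℝ × ℝ → ℝ}
    (hF : ∀ l ∈ grid N, F l = P.laplacian u (P.node N l) + P.K * u (P.node N l))
    (hδ : |F (k - s.inward) - (3 * F k - 3 * F (k + s.inward) + F (k + s.inward + s.inward))| ≤ δ)
    (hg : P.normalDeriv s u (P.node N k) + P.σ * u (P.node N k) = g (P.node N k)) :
    |P.fluxLhs N s (u ∘ P.node N) k - P.fluxRhs N s F g k|
      ≤ 8256 * (M₅ + |P.K| * M₃) * P.h N ^ 3 + δ := by
  have hh := h_pos hl hN
  set c := P.sideJet s u (P.node N k) with hc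
  have hu3 : ContDiffOn ℝ (3 : ℕ) u P.domain := hu.of_le (by norm_cast)
  have l1 : k + s.tangent = k + (0 : ℤ) • s.inward + (1 : ℤ) • s.tangent := by module
  have l2 : k - s.tangent = k + (0 : ℤ) • s.inward + (-1 : ℤ) • s.tangent := by module
  have l3 : k + s.inward = k + (1 : ℤ) • s.inward + (0 : ℤ) • s.tangent := by module
  have l4 : k + s.inward + s.tangent = k + (1 : ℤ) • s.inward + (1 : ℤ) • s.tangent := by module
  have l5 : k + s.inward - s.tangent = k + (1 : ℤ) • s.inward + (-1 : ℤ) • s.tangent := by module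
  have l6 : k + s.inward + s.inward = k + (2 : ℤ) • s.inward + (0 : ℤ) • s.tangent := by module
  have T5 : ∀ (l : ℤ × ℤ) (a b : ℤ), 0 ≤ a → a ≤ 2 → |b| ≤ 1 →
      l = k + a • s.inward + b • s.tangent →
      |u (P.node N l) - taylorPoly c 5 (a * P.h N) (b * P.h N)| ≤ 192 * M₅ * P.h N ^ 5 := by
    intro l a b ha ha2 hb hlk
    convert abs_side_sub_taylorPoly_le hl hN hu hM₅ hk ha ha2 hb hlk using 1
    norm_num; ring
  have T3 : ∀ (l : ℤ × ℤ) (a b : ℤ), 0 ≤ a → a ≤ 2 → |b| ≤ 1 →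
      l = k + a • s.inward + b • s.tangent →
      |u (P.node N l) - taylorPoly c 3 (a * P.h N) (b * P.h N)| ≤ 32 * M₃ * P.h N ^ 3 := by
    intro l a b ha ha2 hb hlk
    convert abs_side_sub_taylorPoly_le hl hN hu3 hM₃ hk ha ha2 hb hlk using 1
    norm_num; ring
  have TL : ∀ (l : ℤ × ℤ) (a b : ℤ), 0 ≤ a → a ≤ 2 → |b| ≤ 1 →
      l = k + a • s.inward + b • s.tangent →
      |P.laplacian u (P.node N l) - taylorPoly (lapJet c) 3 (a * P.h N) (b * P.h N)|
        ≤ 64 * M₅ * P.h N ^ 3 := by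
    intro l a b ha ha2 hb hlk
    convert abs_side_laplacian_sub_taylorPoly_le (n := 3) hl hN hu hM₅ hk ha ha2 hb hlk using 1
    norm_num; ring
  have e1 := T5 _ _ _ le_rfl (by norm_num) (by norm_num) l1
  have e2 := T5 _ _ _ le_rfl (by norm_num) (by norm_num) l2
  have e3 := T5 _ _ _ (by norm_num) (by norm_num) (by norm_num) l3
  have e4 := T5 _ _ _ (by norm_num) (by norm_num) (by norm_num) l4
  have e5 := T5 _ _ _ (by norm_num) (by norm_num) (by norm_num) l5
  have f1 := T3 _ _ _ le_rfl (by norm_num) (by norm_num) l1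
  have f2 := T3 _ _ _ le_rfl (by norm_num) (by norm_num) l2
  have f3 := T3 _ _ _ (by norm_num) (by norm_num) (by norm_num) l3
  have f4 := T3 _ _ _ (by norm_num) (by norm_num) (by norm_num) l6
  have d1 := TL _ _ _ le_rfl (by norm_num) (by norm_num) l1
  have d2 := TL _ _ _ le_rfl (by norm_num) (by norm_num) l2
  have d3 := TL _ _ _ (by norm_num) (by norm_num) (by norm_num) l3
  have d4 := TL _ _ _ (by norm_num) (by norm_num) (by norm_num) l6
  push_cast at e1 e2 e3 e4 e5 f1 f2 f3 f4 d1 d2 d3 d4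
  have Q1 := abs_sixPoint_le hh e1 e2 e3 e4 e5 d1 d2 d3 d4
  have Q2 := abs_sixPoint_lowerOrder_le f1 f2 f3 f4
  have m1 : k + s.tangent ∈ grid N :=
    l1 ▸ mem_grid_of_mem_sideGrid hk le_rfl (by norm_num) (by norm_num)
  have m2 : k - s.tangent ∈ grid N :=
    l2 ▸ mem_grid_of_mem_sideGrid hk le_rfl (by norm_num) (by norm_num)
  have m3 : k + s.inward ∈ grid N :=
    l3 ▸ mem_grid_of_mem_sideGrid hk (by norm_num) (by norm_num) (by norm_num)
  have m6 : k + s.inward + s.inward ∈ grid N :=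
    l6 ▸ mem_grid_of_mem_sideGrid hk (by norm_num) (by norm_num) (by norm_num)
  have m0 : k ∈ grid N := sideGrid_subset_grid s hk
  have h12 := twelve_le_lam hK N
  have hlam : P.lam N = 12 - P.K * P.h N ^ 2 := rfl
  have hc0 : u (P.node N k) = c 0 0 := (sideJet_zero s u _).symm
  have hL0 : P.laplacian u (P.node N k) = lapJet c 0 0 := (lapJet_sideJet_zero s u _).symm
  have hFk := hF k m0
  have hF3 := hF _ m3
  have hF6 := hF _ m6
  rw [normalDeriv_eq_sideJet, ← hc, hc0] at hg
  rw [hc0, hL0] at hFk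
  set D := F (k - s.inward) - (3 * F k - 3 * F (k + s.inward) + F (k + s.inward + s.inward)) with hD
  have hFe : F (k - s.inward) = D + (3 * F k - 3 * F (k + s.inward) + F (k + s.inward + s.inward)) := by
    rw [hD]; ring
  set X := 8 * u (P.node N (k + s.tangent)) + 8 * u (P.node N (k - s.tangent))
    + 4 * u (P.node N (k + s.inward + s.tangent)) + 4 * u (P.node N (k + s.inward - s.tangent))
    + 16 * u (P.node N (k + s.inward)) - 40 * c 0 0 - P.h N ^ 2 *
      (P.laplacian u (P.node N (k + s.tangent)) + P.laplacian u (P.node N (k - s.tangent))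
      - (3 * lapJet c 0 0 - 3 * P.laplacian u (P.node N (k + s.inward))
        + P.laplacian u (P.node N (k + s.inward + s.inward))) + 8 * lapJet c 0 0
      + 3 * P.laplacian u (P.node N (k + s.inward))) - 24 * P.h N * c 1 0 with hX
  set Y := 12 * c 0 0 - (u (P.node N (k + s.tangent)) + u (P.node N (k - s.tangent))
    - (3 * c 0 0 - 3 * u (P.node N (k + s.inward)) + u (P.node N (k + s.inward + s.inward)))
    + 8 * c 0 0 + 3 * u (P.node N (k + s.inward))) + P.h N ^ 2 * lapJet c 0 0
    + 4 * P.h N * c 1 0 with hY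
  -- Inserting g = ∂u/∂n + σu removes every σ, and f = Δu + Ku together with λ = 12 - Kh² removes
  -- the K² terms. `X` is free of K, `Y` collects the coefficient of Kh², and `D` is the signed
  -- extension defect.
  have key : P.lam N * P.h N ^ 2 * (P.fluxLhs N s (u ∘ P.node N) k - P.fluxRhs N s F g k)
      = X + P.K * P.h N ^ 2 * Y + P.h N ^ 2 * D := by
    unfold fluxLhs fluxRhs
    rw [← hg, hFe, hF _ m1, hF _ m2, hF3, hF6, hFk]
    simp only [Function.comp, hc0]
    have hlam0 : P.lam N ≠ 0 := by linarith
    have hh0 := hh.ne'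
    have s1 : ∀ x y z w : ℝ, P.lam N * P.h N ^ 2 *
        (1 / (P.lam N * P.h N ^ 2) * x - (1 / P.lam N * y + z / (P.lam N * P.h N) * w))
        = x - (P.h N ^ 2 * y + P.h N * z * w) := by
      intro x y z w; field_simp
    rw [s1, hX, hY, hlam]
    ring
  exact abs_fluxResidual_le hh (by linarith)
    ((abs_nonneg _).trans (hM₃ _ (node_mem_domain hl hN m0) 3 0 rfl)) key Q1 Q2 hδ

end Grid

/-! ### Control of intermediate derivatives -/

section Interpolation

variable {P : FluxProblem} {u : ℝ × ℝ → ℝ}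

lemma abs_partialDeriv_sub_le_x (hl : 0 < P.len) {m : ℕ} {B : ℝ}
    (hu : ContDiffOn ℝ (m + 1 : ℕ) u P.domain) (hB : P.DerivLE u (m + 1) P.domain B)
    {i j : ℕ} (hij : i + j = m) {x x' y : ℝ} (hx : x ∈ P.xInterval) (hx' : x' ∈ P.xInterval)
    (hy : y ∈ P.yInterval) :
    |P.partialDeriv u i j (x, y) - P.partialDeriv u i j (x', y)| ≤ P.len * B := by
  have h1 := (convex_Icc _ _ : Convex ℝ P.xInterval).norm_image_sub_le_of_norm_hasDerivWithin_le
    (f := fun s => P.partialDeriv u i j (s, y)) (f' := fun s => P.partialDeriv u (i + 1) j (s, y))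
    (C := B) (fun s hs => hasDerivWithinAt_partialDeriv_x (p := (s, y)) hl hu (by omega) ⟨hs, hy⟩)
    (fun s hs => hB (s, y) ⟨hs, hy⟩ _ _ (by omega)) hx' hx
  have hB0 : 0 ≤ B := (abs_nonneg _).trans (hB (x, y) ⟨hx, hy⟩ (i + 1) j (by omega))
  refine h1.trans ?_
  rw [mul_comm, Real.norm_eq_abs]
  gcongr
  rw [abs_le]
  constructor <;> linarith [hx.1, hx.2, hx'.1, hx'.2]

lemma abs_partialDeriv_sub_le_y (hl : 0 < P.len) {m : ℕ} {B : ℝ}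
    (hu : ContDiffOn ℝ (m + 1 : ℕ) u P.domain) (hB : P.DerivLE u (m + 1) P.domain B)
    {i j : ℕ} (hij : i + j = m) {x y y' : ℝ} (hx : x ∈ P.xInterval) (hy : y ∈ P.yInterval)
    (hy' : y' ∈ P.yInterval) :
    |P.partialDeriv u i j (x, y) - P.partialDeriv u i j (x, y')| ≤ P.len * B := by
  have h1 := (convex_Icc _ _ : Convex ℝ P.yInterval).norm_image_sub_le_of_norm_hasDerivWithin_le
    (f := fun t => P.partialDeriv u i j (x, t)) (f' := fun t => P.partialDeriv u i (j + 1) (x, t))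
    (C := B) (fun t ht => hasDerivWithinAt_partialDeriv_y (p := (x, t)) hl hu (by omega) ⟨hx, ht⟩)
    (fun t ht => hB (x, t) ⟨hx, ht⟩ _ _ (by omega)) hy' hy
  have hB0 : 0 ≤ B := (abs_nonneg _).trans (hB (x, y) ⟨hx, hy⟩ (i + 1) j (by omega))
  refine h1.trans ?_
  rw [mul_comm, Real.norm_eq_abs]
  gcongr
  rw [abs_le]
  constructor <;> linarith [hy.1, hy.2, hy'.1, hy'.2]

lemma left_mem_xInterval (hl : 0 < P.len) : P.xl ∈ P.xInterval := ⟨le_rfl, by linarith⟩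

lemma left_mem_yInterval (hl : 0 < P.len) : P.yl ∈ P.yInterval := ⟨le_rfl, by linarith⟩

/-- Derivatives are controlled by their boundary values and the derivatives of the next order. -/
lemma DerivLE.of_bdry (hl : 0 < P.len) {m : ℕ} {A B : ℝ}
    (hu : ContDiffOn ℝ (m + 1 : ℕ) u P.domain) (hA : P.DerivLE u m P.bdry A)
    (hB : P.DerivLE u (m + 1) P.domain B) : P.DerivLE u m P.domain (A + P.len * B) := by
  intro p hp i j hij
  have h1 := abs_partialDeriv_sub_le_x hl hu hB hij hp.1 (left_mem_xInterval hl) hp.2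
  have h2 := hA (P.xl, p.2) ⟨⟨left_mem_xInterval hl, hp.2⟩, Or.inl rfl⟩ i j hij
  have h3 := abs_sub_abs_le_abs_sub (P.partialDeriv u i j (p.1, p.2)) (P.partialDeriv u i j (P.xl, p.2))
  linarith

lemma exists_abs_deriv_le {φ φ' : ℝ → ℝ} {a l A : ℝ} (hl : 0 < l)
    (hφ : ∀ t ∈ Set.Icc a (a + l), HasDerivWithinAt φ (φ' t) (Set.Icc a (a + l)) t)
    (hA : ∀ t ∈ Set.Icc a (a + l), |φ t| ≤ A) :
    ∃ t ∈ Set.Icc a (a + l), |φ' t| ≤ 2 * A / l := by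
  obtain ⟨t, ht, h⟩ := exists_hasDerivAt_eq_slope φ φ' (by linarith : a < a + l)
    (fun t ht => (hφ t ht).continuousWithinAt)
    (fun t ht => (hφ t ⟨ht.1.le, ht.2.le⟩).hasDerivAt (Icc_mem_nhds ht.1 ht.2))
  refine ⟨t, ⟨ht.1.le, ht.2.le⟩, ?_⟩
  rw [h, add_sub_cancel_left, abs_div, abs_of_pos hl]
  gcongr
  have h1 := hA a ⟨le_rfl, by linarith⟩
  have h2 := hA (a + l) ⟨by linarith, le_rfl⟩
  exact (abs_sub _ _).trans (by linarith)

/-- Derivatives are controlled by the boundary values of the derivatives one order below, and the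
derivatives one order above. -/
lemma DerivLE.of_bdry_pred (hl : 0 < P.len) {m : ℕ} {A B : ℝ}
    (hu : ContDiffOn ℝ (m + 2 : ℕ) u P.domain) (hA : P.DerivLE u m P.bdry A)
    (hB : P.DerivLE u (m + 2) P.domain B) :
    P.DerivLE u (m + 1) P.domain (2 * A / P.len + 2 * P.len * B) := by
  intro p hp i j hij
  obtain ⟨q, hq, h⟩ : ∃ q ∈ P.domain, |P.partialDeriv u i j q| ≤ 2 * A / P.len := by
    have hx0 := left_mem_xInterval (P := P) hl
    have hy0 := left_mem_yInterval (P := P) hl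
    -- The derivative is to be tangential along a side where the lower order bound is known: a
    -- y-derivative is spent on the left side, and if there is none, an x-derivative on the bottom
    -- side.
    cases j with
    | succ j =>
      obtain ⟨t, ht, h⟩ := exists_abs_deriv_le hl
        (φ := fun t => P.partialDeriv u i j (P.xl, t))
        (φ' := fun t => P.partialDeriv u i (j + 1) (P.xl, t)) (a := P.yl)
        (fun t ht => hasDerivWithinAt_partialDeriv_y (p := (P.xl, t)) hl hu (by omega) ⟨hx0, ht⟩)
        (fun t ht => hA (P.xl, t) ⟨⟨hx0, ht⟩, Or.inl rfl⟩ i j (by omega))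
      exact ⟨(P.xl, t), ⟨hx0, ht⟩, h⟩
    | zero =>
      obtain rfl : i = m + 1 := by omega
      obtain ⟨t, ht, h⟩ := exists_abs_deriv_le hl
        (φ := fun t => P.partialDeriv u m 0 (t, P.yl))
        (φ' := fun t => P.partialDeriv u (m + 1) 0 (t, P.yl)) (a := P.xl)
        (fun t ht => hasDerivWithinAt_partialDeriv_x (p := (t, P.yl)) hl hu (by omega) ⟨ht, hy0⟩)
        (fun t ht => hA (t, P.yl) ⟨⟨ht, hy0⟩, Or.inr (Or.inr (Or.inl rfl))⟩ m 0 rfl)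
      exact ⟨(t, P.yl), ⟨ht, hy0⟩, h⟩
  have h1 := abs_partialDeriv_sub_le_x hl hu hB hij hp.1 hq.1 hp.2
  have h2 := abs_partialDeriv_sub_le_y hl hu hB hij hq.1 hp.2 hq.2
  have h3 := abs_sub_abs_le_abs_sub (P.partialDeriv u i j (p.1, p.2)) (P.partialDeriv u i j (q.1, p.2))
  have h4 := abs_sub_abs_le_abs_sub (P.partialDeriv u i j (q.1, p.2)) (P.partialDeriv u i j (q.1, q.2))
  linarith

lemma derivBound_nonneg : 0 ≤ P.derivBound u := supDeriv_nonneg.trans (le_max_left _ _)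

lemma derivLE_six (hl : 0 < P.len) (hu : ContDiffOn ℝ (6 : ℕ) u P.domain) :
    P.DerivLE u 6 P.domain (P.derivBound u) := fun p hp i j hij =>
  (derivLE_supDeriv hl hu le_rfl subset_rfl p hp i j hij).trans (le_max_left _ _)

lemma derivLE_five (hl : 0 < P.len) (hu : ContDiffOn ℝ (6 : ℕ) u P.domain) :
    P.DerivLE u 5 P.domain ((1 + P.len) * P.derivBound u) := by
  have h := DerivLE.of_bdry (m := 5) hl hu (fun p hp i j hij =>
    (derivLE_supDeriv hl hu (by norm_num) bdry_subset_domain p hp i j hij).trans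
    (le_max_right (P.supDeriv 6 u P.domain) _)) (derivLE_six hl hu)
  convert h using 1
  rw [add_mul, one_mul]; rfl

/-- The error bound contains no fourth derivatives. They are eliminated between D³u on the boundary
and D⁵u inside, after which one integration from the boundary reaches D³u. -/
lemma derivLE_three (hl : 0 < P.len) (hu : ContDiffOn ℝ (6 : ℕ) u P.domain) :
    P.DerivLE u 3 P.domain (3 * P.supDeriv 3 u P.bdry
      + 2 * P.len ^ 2 * (1 + P.len) * P.derivBound u) := by
  have hA := derivLE_supDeriv hl hu (by norm_num : 3 ≤ 6) bdry_subset_domain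
  have h4 := DerivLE.of_bdry_pred (m := 3) hl (hu.of_le (by norm_cast)) hA (derivLE_five hl hu)
  have h := DerivLE.of_bdry (m := 3) hl (hu.of_le (by norm_cast)) hA h4
  convert h using 1
  field_simp
  ring

end Interpolation

/-! ### The discrete equations -/

section Discrete

variable {P : FluxProblem} {N : ℕ} {k l : ℤ × ℤ}

/-- The operator of the scheme at the interior grid points. -/
noncomputable def interiorOp (P : FluxProblem) (N : ℕ) (e : ℤ × ℤ → ℝ) (k : ℤ × ℤ) : ℝ :=
  P.Lh N e k + P.K * Mh e k

lemma finite_grid (N : ℕ) : (grid N).Finite := by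
  refine ((Set.finite_Icc (0 : ℤ) N).prod (Set.finite_Icc (0 : ℤ) N)).subset ?_
  rintro k ⟨h1, h2, h3, h4⟩
  exact ⟨⟨h1, h2⟩, ⟨h3, h4⟩⟩

lemma interiorGrid_subset_grid : interiorGrid N ⊆ grid N := by
  rintro k ⟨h1, h2, h3, h4⟩
  exact ⟨h1.le, h2.le, h3.le, h4.le⟩

lemma add_mem_grid_of_mem_interiorGrid (hk : k ∈ interiorGrid N) {a b : ℤ} (ha : |a| ≤ 1)
    (hb : |b| ≤ 1) : k + (a, b) ∈ grid N := by
  obtain ⟨h1, h2, h3, h4⟩ := hk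
  rw [abs_le] at ha hb
  refine ⟨?_, ?_, ?_, ?_⟩ <;> simp <;> omega

/-- The points of the flux formula belong to the grid. -/
lemma sixPoints_mem_grid {s : SquareSide} (hk : k ∈ sideGrid N s) :
    k + s.tangent ∈ grid N ∧ k + s.inward + s.tangent ∈ grid N ∧ k ∈ grid N ∧
      k + s.inward ∈ grid N ∧ k - s.tangent ∈ grid N ∧ k + s.inward - s.tangent ∈ grid N := by
  cases s <;> obtain ⟨h1, h2, h3⟩ := hk <;>
    simp [grid, SquareSide.inward, SquareSide.tangent] <;> omega

lemma ninePoints_mem_grid (hk : k ∈ interiorGrid N) :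
    k + (1, 1) ∈ grid N ∧ k + (1, -1) ∈ grid N ∧ k + (-1, 1) ∈ grid N ∧ k + (-1, -1) ∈ grid N ∧
    k + (1, 0) ∈ grid N ∧ k + (-1, 0) ∈ grid N ∧ k + (0, 1) ∈ grid N ∧ k + (0, -1) ∈ grid N ∧
    k ∈ grid N :=
  ⟨add_mem_grid_of_mem_interiorGrid hk (by norm_num) (by norm_num),
   add_mem_grid_of_mem_interiorGrid hk (by norm_num) (by norm_num),
   add_mem_grid_of_mem_interiorGrid hk (by norm_num) (by norm_num),
   add_mem_grid_of_mem_interiorGrid hk (by norm_num) (by norm_num),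
   add_mem_grid_of_mem_interiorGrid hk (by norm_num) (by norm_num),
   add_mem_grid_of_mem_interiorGrid hk (by norm_num) (by norm_num),
   add_mem_grid_of_mem_interiorGrid hk (by norm_num) (by norm_num),
   add_mem_grid_of_mem_interiorGrid hk (by norm_num) (by norm_num), interiorGrid_subset_grid hk⟩

lemma Mh_congr {e f : ℤ × ℤ → ℝ} (hef : Set.EqOn e f (grid N)) (hk : k ∈ interiorGrid N) :
    Mh e k = Mh f k := by
  obtain ⟨_, _, _, _, h5, h6, h7, h8, h9⟩ := ninePoints_mem_grid hk
  simp only [Mh, hef h5, hef h6, hef h7, hef h8, hef h9]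

lemma interiorOp_congr {e f : ℤ × ℤ → ℝ} (hef : Set.EqOn e f (grid N)) (hk : k ∈ interiorGrid N) :
    P.interiorOp N e k = P.interiorOp N f k := by
  obtain ⟨h1, h2, h3, h4, h5, h6, h7, h8, h9⟩ := ninePoints_mem_grid hk
  simp only [interiorOp, Lh, Mh, hef h1, hef h2, hef h3, hef h4, hef h5, hef h6, hef h7, hef h8,
    hef h9]

lemma fluxLhs_congr {e f : ℤ × ℤ → ℝ} (hef : Set.EqOn e f (grid N)) {s : SquareSide}
    (hk : k ∈ sideGrid N s) : P.fluxLhs N s e k = P.fluxLhs N s f k := by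
  obtain ⟨h1, h2, h3, h4, h5, h6⟩ := sixPoints_mem_grid hk
  simp only [fluxLhs, hef h1, hef h2, hef h3, hef h4, hef h5, hef h6]

lemma node_fst_eq_iff (hl : 0 < P.len) (hN : 1 ≤ N) :
    ((P.node N k).1 = P.xl ↔ k.1 = 0) ∧ ((P.node N k).1 = P.xl + P.len ↔ k.1 = N) := by
  have hh := (h_pos hl hN).ne'
  constructor
  · simp [node, hh]
  · rw [← cast_mul_h (P := P) hN]
    simp only [node, add_right_inj, mul_left_inj' hh]
    norm_cast

lemma node_snd_eq_iff (hl : 0 < P.len) (hN : 1 ≤ N) :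
    ((P.node N k).2 = P.yl ↔ k.2 = 0) ∧ ((P.node N k).2 = P.yl + P.len ↔ k.2 = N) := by
  have hh := (h_pos hl hN).ne'
  constructor
  · simp [node, hh]
  · rw [← cast_mul_h (P := P) hN]
    simp only [node, add_right_inj, mul_left_inj' hh]
    norm_cast

lemma node_mem_bdry_iff (hl : 0 < P.len) (hN : 1 ≤ N) (hk : k ∈ grid N) :
    P.node N k ∈ P.bdry ↔ k ∉ interiorGrid N := by
  obtain ⟨x1, x2⟩ := node_fst_eq_iff (k := k) hl hN
  obtain ⟨y1, y2⟩ := node_snd_eq_iff (k := k) hl hN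
  simp only [bdry, Set.mem_ofPred_eq, x1, x2, y1, y2, node_mem_domain hl hN hk, true_and,
    interiorGrid]
  obtain ⟨h1, h2, h3, h4⟩ := hk
  omega

lemma mem_sideGrid_of_node_mem_openSide (hl : 0 < P.len) (hN : 1 ≤ N) (hk : k ∈ grid N)
    {s : SquareSide} (h : P.node N k ∈ P.openSide s) : k ∈ sideGrid N s := by
  obtain ⟨x1, x2⟩ := node_fst_eq_iff (k := k) hl hN
  obtain ⟨y1, y2⟩ := node_snd_eq_iff (k := k) hl hN
  obtain ⟨h1, h2, h3, h4⟩ := hk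
  cases s <;> obtain ⟨a, b⟩ := h
  · have := y1.not.1 b.1.ne'
    have := y2.not.1 b.2.ne
    exact ⟨x1.1 a, by omega, by omega⟩
  · have := y1.not.1 b.1.ne'
    have := y2.not.1 b.2.ne
    exact ⟨x2.1 a, by omega, by omega⟩
  · have := x1.not.1 a.1.ne'
    have := x2.not.1 a.2.ne
    exact ⟨by omega, by omega, y1.1 b⟩
  · have := x1.not.1 a.1.ne'
    have := x2.not.1 a.2.ne
    exact ⟨by omega, by omega, y2.1 b⟩

lemma node_mem_openSide (hl : 0 < P.len) (hN : 1 ≤ N)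
    {s : SquareSide} (hk : k ∈ sideGrid N s) : P.node N k ∈ P.openSide s := by
  obtain ⟨x1, x2⟩ := node_fst_eq_iff (k := k) hl hN
  obtain ⟨y1, y2⟩ := node_snd_eq_iff (k := k) hl hN
  obtain ⟨⟨d1, d2⟩, ⟨d3, d4⟩⟩ := node_mem_domain (P := P) hl hN (sideGrid_subset_grid s hk)
  cases s <;> obtain ⟨h1, h2, h3⟩ := hk
  · exact ⟨x1.2 h1, lt_of_le_of_ne d3 fun h => by have := y1.1 h.symm; omega,
      lt_of_le_of_ne d4 fun h => by have := y2.1 h; omega⟩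
  · exact ⟨x2.2 h1, lt_of_le_of_ne d3 fun h => by have := y1.1 h.symm; omega,
      lt_of_le_of_ne d4 fun h => by have := y2.1 h; omega⟩
  · exact ⟨⟨lt_of_le_of_ne d1 fun h => by have := x1.1 h.symm; omega,
      lt_of_le_of_ne d2 fun h => by have := x2.1 h; omega⟩, y1.2 h3⟩
  · exact ⟨⟨lt_of_le_of_ne d1 fun h => by have := x1.1 h.symm; omega,
      lt_of_le_of_ne d2 fun h => by have := x2.1 h; omega⟩, y2.2 h3⟩

/-- The side to which a boundary grid point belongs. -/
def sideOf (N : ℕ) (k : ℤ × ℤ) : SquareSide :=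
  if k.1 = 0 then .left else if k.1 = N then .right else if k.2 = 0 then .bottom else .top

lemma sideOf_eq {s : SquareSide} (hk : k ∈ sideGrid N s) : sideOf N k = s := by
  cases s <;> obtain ⟨h1, h2, h3⟩ := hk <;> unfold sideOf <;> split_ifs <;> first | rfl | omega

open Classical in
/-- The left hand sides of the finite difference equations, one for each grid point. -/
noncomputable def schemeOp (P : FluxProblem) (N : ℕ) (e : ℤ × ℤ → ℝ) (k : ℤ × ℤ) : ℝ :=
  if k ∈ interiorGrid N then P.interiorOp N e k
  else if P.node N k ∈ P.fluxPart then P.fluxLhs N (sideOf N k) e k else e k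

lemma schemeOp_interior {e : ℤ × ℤ → ℝ} (hk : k ∈ interiorGrid N) :
    P.schemeOp N e k = P.interiorOp N e k := if_pos hk

lemma not_mem_interiorGrid_of_mem_sideGrid {s : SquareSide} (hk : k ∈ sideGrid N s) :
    k ∉ interiorGrid N := by
  rintro ⟨a, b, c, d⟩
  cases s <;> obtain ⟨h1, h2, h3⟩ := hk <;> omega

lemma schemeOp_flux {e : ℤ × ℤ → ℝ} {s : SquareSide} (hk : k ∈ sideGrid N s)
    (hf : P.node N k ∈ P.fluxPart) : P.schemeOp N e k = P.fluxLhs N s e k := by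
  rw [schemeOp, if_neg (not_mem_interiorGrid_of_mem_sideGrid hk), if_pos hf, sideOf_eq hk]

lemma schemeOp_dirichlet {e : ℤ × ℤ → ℝ} (hk : k ∉ interiorGrid N)
    (hf : P.node N k ∉ P.fluxPart) : P.schemeOp N e k = e k := by
  rw [schemeOp, if_neg hk, if_neg hf]

/-- Every grid point is an interior point, a Dirichlet point or a flux point. -/
lemma grid_cases (hl : 0 < P.len) (hflux : P.fluxPart ⊆ ⋃ s, P.openSide s) (hN : 1 ≤ N)
    (hk : k ∈ grid N) : k ∈ interiorGrid N ∨ (k ∉ interiorGrid N ∧ P.node N k ∉ P.fluxPart) ∨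
      ∃ s, k ∈ sideGrid N s ∧ P.node N k ∈ P.fluxPart := by
  by_cases hf : P.node N k ∈ P.fluxPart
  · obtain ⟨s, hs⟩ := Set.mem_iUnion.1 (hflux hf)
    exact Or.inr (Or.inr ⟨s, mem_sideGrid_of_node_mem_openSide hl hN hk hs, hf⟩)
  · by_cases hi : k ∈ interiorGrid N
    · exact Or.inl hi
    · exact Or.inr (Or.inl ⟨hi, hf⟩)

/-- No stencil leaves the grid, so the scheme on functions on ℤ² is really a square system on the
finite grid. -/
lemma schemeOp_congr (hl : 0 < P.len) (hflux : P.fluxPart ⊆ ⋃ s, P.openSide s) (hN : 1 ≤ N)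
    {e f : ℤ × ℤ → ℝ} (hef : Set.EqOn e f (grid N)) :
    Set.EqOn (P.schemeOp N e) (P.schemeOp N f) (grid N) := by
  intro k hk
  obtain hi | ⟨hi, hf⟩ | ⟨s, hs, hf⟩ := grid_cases hl hflux hN hk
  · rw [schemeOp_interior hi, schemeOp_interior hi, interiorOp_congr hef hi]
  · rw [schemeOp_dirichlet hi hf, schemeOp_dirichlet hi hf, hef hk]
  · rw [schemeOp_flux hs hf, schemeOp_flux hs hf, fluxLhs_congr hef hs]

lemma interiorOp_add (e f : ℤ × ℤ → ℝ) (k : ℤ × ℤ) :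
    P.interiorOp N (e + f) k = P.interiorOp N e k + P.interiorOp N f k := by
  simp only [interiorOp, Lh, Mh, Pi.add_apply]; ring

lemma interiorOp_smul (c : ℝ) (e : ℤ × ℤ → ℝ) (k : ℤ × ℤ) :
    P.interiorOp N (c • e) k = c * P.interiorOp N e k := by
  simp only [interiorOp, Lh, Mh, Pi.smul_apply, smul_eq_mul]; ring

lemma fluxLhs_add (s : SquareSide) (e f : ℤ × ℤ → ℝ) (k : ℤ × ℤ) :
    P.fluxLhs N s (e + f) k = P.fluxLhs N s e k + P.fluxLhs N s f k := by
  simp only [fluxLhs, Pi.add_apply]; ring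

lemma fluxLhs_smul (c : ℝ) (s : SquareSide) (e : ℤ × ℤ → ℝ) (k : ℤ × ℤ) :
    P.fluxLhs N s (c • e) k = c * P.fluxLhs N s e k := by
  simp only [fluxLhs, Pi.smul_apply, smul_eq_mul]; ring

lemma schemeOp_add (e f : ℤ × ℤ → ℝ) (k : ℤ × ℤ) :
    P.schemeOp N (e + f) k = P.schemeOp N e k + P.schemeOp N f k := by
  unfold schemeOp; split_ifs
  · exact interiorOp_add _ _ _
  · exact fluxLhs_add _ _ _ _
  · rfl

lemma schemeOp_smul (c : ℝ) (e : ℤ × ℤ → ℝ) (k : ℤ × ℤ) :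
    P.schemeOp N (c • e) k = c * P.schemeOp N e k := by
  unfold schemeOp; split_ifs
  · exact interiorOp_smul _ _ _
  · exact fluxLhs_smul _ _ _ _
  · rfl

/-- The operator of the scheme on the functions on the grid. -/
noncomputable def schemeLinearMap (P : FluxProblem) (N : ℕ) :
    (grid N → ℝ) →ₗ[ℝ] (grid N → ℝ) where
  toFun e k := P.schemeOp N (Function.extend Subtype.val e 0) k
  map_add' e f := by
    funext k
    rw [Pi.add_apply, ← schemeOp_add, ← Function.extend_add, add_zero]
  map_smul' c e := by
    funext k
    rw [Pi.smul_apply, RingHom.id_apply, smul_eq_mul, ← schemeOp_smul, ← Function.extend_smul,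
      smul_zero]

/-! ### Trivial kernel of the scheme by diagonal dominance -/

lemma ninePoint_ne_zero {α κ M z c₁ c₂ c₃ c₄ s₁ s₂ s₃ s₄ : ℝ} (hα : 0 < α) (hκ : 0 ≤ κ)
    (hM : 0 < M) (hz : |z| = M) (h1 : |c₁| ≤ M) (h2 : |c₂| ≤ M) (h3 : |c₃| ≤ M) (h4 : |c₄| ≤ M)
    (h5 : |s₁| ≤ M) (h6 : |s₂| < M) (h7 : |s₃| ≤ M) (h8 : |s₄| ≤ M) :
    α * (c₁ + c₂ + c₃ + c₄ + 4 * (s₁ + s₂ + s₃ + s₄) - 20 * z)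
      - κ * (s₁ + s₂ + s₃ + s₄ + 8 * z) ≠ 0 := by
  intro h
  -- On coarse grids 4α - κ may be negative, so dominance is taken in absolute value: 4α + 4|4α - κ|
  -- ≤ 20α + 4κ. If κ = 0 this only balances the diagonal, and the strict bound on s₂ decides.
  have e : (20 * α + 8 * κ) * z = α * (c₁ + c₂ + c₃ + c₄) + (4 * α - κ) * (s₁ + s₂ + s₃ + s₄) := by
    linarith
  have hc : |c₁ + c₂ + c₃ + c₄| ≤ 4 * M := by
    rw [abs_le] at *; constructor <;> linarith
  have hs : |s₁ + s₂ + s₃ + s₄| < 4 * M := by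
    rw [abs_le] at h5 h7 h8; rw [abs_lt] at *; constructor <;> linarith
  have hd : |4 * α - κ| ≤ 4 * α + κ := by rw [abs_le]; constructor <;> linarith
  have h9 := congrArg abs e
  rw [abs_mul, hz, abs_of_pos (by positivity)] at h9
  have h10 : (20 * α + 8 * κ) * M ≤ α * (4 * M) + (4 * α + κ) * |s₁ + s₂ + s₃ + s₄| := by
    rw [h9]
    refine (abs_add_le _ _).trans ?_
    rw [abs_mul, abs_mul, abs_of_pos hα]
    gcongr
  have h11 : (4 * α + κ) * |s₁ + s₂ + s₃ + s₄| < (4 * α + κ) * (4 * M) := by gcongr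
  nlinarith

/-- The neighbour weights add up to exactly 40, so a single strictly smaller neighbour breaks the
balance. -/
lemma sixPoint_ne_zero {d M z v₁ v₂ w₀ w₁ w₂ : ℝ} (hd : 40 ≤ d) (hM : 0 < M) (hz : |z| = M)
    (h1 : |v₁| ≤ M) (h2 : |v₂| < M) (h3 : |w₀| ≤ M) (h4 : |w₁| ≤ M) (h5 : |w₂| ≤ M) :
    8 * v₁ + 4 * w₁ - d * z + 16 * w₀ + 8 * v₂ + 4 * w₂ ≠ 0 := by
  intro h
  have e : d * z = 8 * v₁ + 4 * w₁ + 16 * w₀ + 8 * v₂ + 4 * w₂ := by linarith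
  have h6 : |8 * v₁ + 4 * w₁ + 16 * w₀ + 8 * v₂ + 4 * w₂| < 40 * M := by
    rw [abs_le] at h1 h3 h4 h5; rw [abs_lt] at *; constructor <;> linarith
  rw [← e, abs_mul, hz, abs_of_pos (by linarith)] at h6
  nlinarith

lemma interiorOp_eq (e : ℤ × ℤ → ℝ) (k : ℤ × ℤ) : P.interiorOp N e k =
    1 / (6 * P.h N ^ 2) * (e (k + (1, 1)) + e (k + (1, -1)) + e (k + (-1, 1)) + e (k + (-1, -1))
      + 4 * (e (k + (1, 0)) + e (k + (-1, 0)) + e (k + (0, 1)) + e (k + (0, -1))) - 20 * e k)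
    - -P.K / 12 * (e (k + (1, 0)) + e (k + (-1, 0)) + e (k + (0, 1)) + e (k + (0, -1))
      + 8 * e k) := by
  simp only [interiorOp, Lh, Mh]; ring

/-- The absolute value of the diagonal coefficient in the flux formula. -/
noncomputable def fluxDiag (P : FluxProblem) (N : ℕ) : ℝ :=
  40 - 4 * P.σ * P.K * P.h N ^ 3 - P.lam N * P.K * P.h N ^ 2 + 24 * P.σ * P.h N

lemma fluxLhs_eq (s : SquareSide) (e : ℤ × ℤ → ℝ) (k : ℤ × ℤ) : P.fluxLhs N s e k =
    1 / (P.lam N * P.h N ^ 2) * (8 * e (k + s.tangent) + 4 * e (k + s.inward + s.tangent)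
      - P.fluxDiag N * e k + 16 * e (k + s.inward)
      + 8 * e (k - s.tangent) + 4 * e (k + s.inward - s.tangent)) := by
  simp only [fluxLhs, fluxDiag]; ring

lemma le_fluxDiag (hl : 0 < P.len) (hK : P.K ≤ 0) (hσ : 0 ≤ P.σ) (hN : 1 ≤ N) :
    40 ≤ P.fluxDiag N := by
  have hh := h_pos hl hN
  have h12 := twelve_le_lam hK N
  have h1 : 0 ≤ 4 * P.σ * (-P.K) * P.h N ^ 3 :=
    mul_nonneg (mul_nonneg (by positivity) (by linarith)) (by positivity)
  have h2 : 0 ≤ P.lam N * (-P.K) * P.h N ^ 2 :=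
    mul_nonneg (mul_nonneg (by linarith) (by linarith)) (by positivity)
  have h3 : 0 ≤ 24 * P.σ * P.h N := by positivity
  unfold fluxDiag
  linarith

/-- At the lexicographically first maximiser of |e| one stencil neighbour is strictly smaller: the
west one inside, the one at k - tangent at a flux point. Dominance excludes both cases, which leaves
a Dirichlet point, where e vanishes. No Dirichlet segment is required, as the corners are never flux
points. -/
lemma eq_zero_of_schemeOp_eq_zero (hl : 0 < P.len) (hflux : P.fluxPart ⊆ ⋃ s, P.openSide s)
    (hK : P.K ≤ 0) (hσ : 0 ≤ P.σ) (hN : 1 ≤ N) {e : ℤ × ℤ → ℝ}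
    (he : ∀ k ∈ grid N, P.schemeOp N e k = 0) : ∀ k ∈ grid N, e k = 0 := by
  have hh := h_pos hl hN
  have h0 : ((0 : ℤ), (0 : ℤ)) ∈ grid N := ⟨le_rfl, by positivity, le_rfl, by positivity⟩
  obtain ⟨m, hm, hmax⟩ := (finite_grid N).exists_maximalFor (fun k => |e k|) _ ⟨_, h0⟩
  replace hmax : ∀ k ∈ grid N, |e k| ≤ |e m| := fun k hk =>
    le_of_not_gt fun h => absurd (hmax hk h.le) (not_le.2 h)
  by_contra! hne
  obtain ⟨z, hz, hz0⟩ := hne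
  set M := |e m| with hM
  have hMpos : 0 < M := (abs_pos.2 hz0).trans_le (hmax z hz)
  have hSfin : {k | k ∈ grid N ∧ |e k| = M}.Finite := (finite_grid N).subset fun k hk => hk.1
  obtain ⟨k, ⟨hk, hkM⟩, hmin⟩ := Set.exists_min_image _ (fun k : ℤ × ℤ => k.1 * (N + 1) + k.2)
    hSfin ⟨m, hm, rfl⟩
  have hlt : ∀ l ∈ grid N, l.1 * (N + 1) + l.2 < k.1 * (N + 1) + k.2 → |e l| < M := by
    intro l hlg hlk
    refine lt_of_le_of_ne (hmax l hlg) fun h => ?_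
    exact absurd (hmin l ⟨hlg, h⟩) (not_le.2 hlk)
  have hop := he k hk
  obtain hi | ⟨hi, hf⟩ | ⟨s, hs, hf⟩ := grid_cases hl hflux hN hk
  · obtain ⟨h1, h2, h3, h4, h5, h6, h7, h8, h9⟩ := ninePoints_mem_grid hi
    rw [schemeOp_interior hi] at hop
    have b1 := hmax _ h1
    have b2 := hmax _ h2
    have b3 := hmax _ h3
    have b4 := hmax _ h4
    have b5 := hmax _ h5
    have b6 := hlt _ h6 (by simp)
    have b7 := hmax _ h7
    have b8 := hmax _ h8
    have hα : 0 < 1 / (6 * P.h N ^ 2) := by positivity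
    rw [interiorOp_eq] at hop
    exact ninePoint_ne_zero hα (by linarith) hMpos hkM b1 b2 b3 b4 b5 b6 b7 b8 hop
  · rw [schemeOp_dirichlet hi hf] at hop
    rw [hop, abs_zero] at hkM
    exact hMpos.ne hkM
  · obtain ⟨h1, h2, h3, h4, h5, h6⟩ := sixPoints_mem_grid hs
    rw [schemeOp_flux hs hf] at hop
    have b1 := hmax _ h1
    have b2 := hmax _ h2
    have b4 := hmax _ h4
    have b5 := hlt _ h5 (by cases s <;> simp [SquareSide.tangent])
    have b6 := hmax _ h6
    have hα : 0 < 1 / (P.lam N * P.h N ^ 2) := by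
      have := twelve_le_lam hK N
      have : 0 < P.lam N := by linarith
      positivity
    rw [fluxLhs_eq] at hop
    exact sixPoint_ne_zero (le_fluxDiag hl hK hσ hN) hMpos hkM b1 b5 b4 b2 b6
      ((mul_eq_zero.1 hop).resolve_left hα.ne')

end Discrete

/-! ### Solvability and stability -/

section Stability

variable {P : FluxProblem} {N : ℕ} {k l : ℤ × ℤ}

lemma extend_coe_apply (e : grid N → ℝ) (k : grid N) :
    Function.extend Subtype.val e (0 : ℤ × ℤ → ℝ) k = e k :=
  Subtype.val_injective.extend_apply _ _ _

lemma injective_schemeLinearMap (hl : 0 < P.len) (hflux : P.fluxPart ⊆ ⋃ s, P.openSide s)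
    (hK : P.K ≤ 0) (hσ : 0 ≤ P.σ) (hN : 1 ≤ N) : Function.Injective (P.schemeLinearMap N) := by
  rw [injective_iff_map_eq_zero]
  intro e he
  funext k
  have := eq_zero_of_schemeOp_eq_zero hl hflux hK hσ hN
    (e := Function.extend Subtype.val e 0) (fun k hk => congrFun he ⟨k, hk⟩) k k.2
  rwa [extend_coe_apply] at this

lemma schemeLinearMap_restrict (hl : 0 < P.len) (hflux : P.fluxPart ⊆ ⋃ s, P.openSide s)
    (hN : 1 ≤ N) (e : ℤ × ℤ → ℝ) (k : grid N) :
    P.schemeLinearMap N (fun l => e l) k = P.schemeOp N e k :=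
  schemeOp_congr hl hflux hN (fun l hl => extend_coe_apply _ ⟨l, hl⟩) k.2

lemma exists_schemeOp_eq (hl : 0 < P.len) (hflux : P.fluxPart ⊆ ⋃ s, P.openSide s)
    (hK : P.K ≤ 0) (hσ : 0 ≤ P.σ) (hN : 1 ≤ N) (r : ℤ × ℤ → ℝ) :
    ∃ U : ℤ × ℤ → ℝ, ∀ k ∈ grid N, P.schemeOp N U k = r k := by
  have := (finite_grid N).to_subtype
  obtain ⟨e, he⟩ := LinearMap.injective_iff_surjective.1
    (injective_schemeLinearMap hl hflux hK hσ hN) (fun k => r k)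
  exact ⟨_, fun k hk => congrFun he ⟨k, hk⟩⟩

/-- Stability on a fixed grid. -/
lemma exists_abs_le_mul_of_abs_schemeOp_le (hl : 0 < P.len)
    (hflux : P.fluxPart ⊆ ⋃ s, P.openSide s) (hK : P.K ≤ 0) (hσ : 0 ≤ P.σ) (hN : 1 ≤ N) :
    ∃ C : ℝ, 0 ≤ C ∧ ∀ (e : ℤ × ℤ → ℝ) (τ : ℝ), (∀ k ∈ grid N, |P.schemeOp N e k| ≤ τ) →
      ∀ k ∈ grid N, |e k| ≤ C * τ := by
  have := (finite_grid N).fintype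
  -- An injective linear map on a finite-dimensional space is bounded below; the constant depends on
  -- N.
  obtain ⟨C, -, hC⟩ := (P.schemeLinearMap N).exists_antilipschitzWith
    (LinearMap.ker_eq_bot.2 (injective_schemeLinearMap hl hflux hK hσ hN))
  refine ⟨C, C.2, fun e τ he k hk => ?_⟩
  have hτ : 0 ≤ τ := (abs_nonneg _).trans (he k hk)
  have h1 := hC.le_mul_dist (fun l : grid N => e l) 0
  rw [map_zero, dist_zero_right, dist_zero_right] at h1
  have h2 : ‖P.schemeLinearMap N (fun l : grid N => e l)‖ ≤ τ := by
    rw [pi_norm_le_iff_of_nonneg hτ]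
    intro l
    rw [schemeLinearMap_restrict hl hflux hN]
    exact he l l.2
  exact (norm_le_pi_norm (fun l : grid N => e l) ⟨k, hk⟩).trans (h1.trans (by gcongr))

/-- Comparison at an interior point, on a sufficiently fine grid. -/
lemma interiorOp_mono (hl : 0 < P.len) (hN : 1 ≤ N) (hK : P.K ≤ 0)
    (hKh : |P.K| * P.h N ^ 2 ≤ 8) {e f : ℤ × ℤ → ℝ} (hef : ∀ l ∈ grid N, e l ≤ f l)
    (hk : k ∈ interiorGrid N) (hke : e k = f k) : P.interiorOp N e k ≤ P.interiorOp N f k := by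
  obtain ⟨h1, h2, h3, h4, h5, h6, h7, h8, h9⟩ := ninePoints_mem_grid hk
  have hα : 0 < 1 / (6 * P.h N ^ 2) := by
    have := h_pos hl hN
    positivity
  -- This is the nonnegativity of the side coefficients 4/(6h²) + K/12, equivalent to |K|h² ≤ 8.
  have hκ : -P.K / 12 ≤ 4 * (1 / (6 * P.h N ^ 2)) := by
    have := h_pos hl hN
    rw [abs_of_nonpos hK] at hKh
    rw [← mul_div_assoc, div_le_div_iff₀ (by norm_num) (by positivity)]
    linarith
  rw [interiorOp_eq, interiorOp_eq, hke]
  have c := add_le_add (add_le_add (add_le_add (hef _ h1) (hef _ h2)) (hef _ h3)) (hef _ h4)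
  have s := add_le_add (add_le_add (add_le_add (hef _ h5) (hef _ h6)) (hef _ h7)) (hef _ h8)
  have p1 := mul_le_mul_of_nonneg_left c hα.le
  have p2 := mul_le_mul_of_nonneg_left s (sub_nonneg.2 hκ)
  linarith

/-- Comparison at a flux point. -/
lemma fluxLhs_mono (hl : 0 < P.len) (hN : 1 ≤ N) (hK : P.K ≤ 0) {e f : ℤ × ℤ → ℝ}
    (hef : ∀ l ∈ grid N, e l ≤ f l) {s : SquareSide} (hk : k ∈ sideGrid N s) (hke : e k = f k) :
    P.fluxLhs N s e k ≤ P.fluxLhs N s f k := by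
  obtain ⟨h1, h2, h3, h4, h5, h6⟩ := sixPoints_mem_grid hk
  have hα : 0 ≤ 1 / (P.lam N * P.h N ^ 2) := by
    have := twelve_le_lam hK N
    have := h_pos hl hN
    have : 0 < P.lam N := by linarith
    positivity
  rw [fluxLhs_eq, fluxLhs_eq, hke]
  refine mul_le_mul_of_nonneg_left ?_ hα
  linarith [hef _ h1, hef _ h2, hef _ h4, hef _ h5, hef _ h6]

/-- Stability from a discrete barrier. -/
lemma abs_le_of_barrier (hl : 0 < P.len) (hflux : P.fluxPart ⊆ ⋃ s, P.openSide s)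
    (hK : P.K ≤ 0) (hN : 1 ≤ N) (hKh : |P.K| * P.h N ^ 2 ≤ 8) {w e : ℤ × ℤ → ℝ} {τ W : ℝ}
    (hw : ∀ k ∈ grid N, 0 < w k) (hW : ∀ k ∈ grid N, w k ≤ W)
    (hwi : ∀ k ∈ interiorGrid N, P.interiorOp N w k ≤ -1)
    (hwf : ∀ s, ∀ k ∈ sideGrid N s, P.node N k ∈ P.fluxPart → P.fluxLhs N s w k ≤ -1 / P.h N)
    (hτ : 0 ≤ τ) (hei : ∀ k ∈ interiorGrid N, |P.interiorOp N e k| ≤ τ)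
    (hef : ∀ s, ∀ k ∈ sideGrid N s, P.node N k ∈ P.fluxPart → |P.fluxLhs N s e k| ≤ τ / P.h N)
    (hed : ∀ k ∈ grid N, k ∉ interiorGrid N → P.node N k ∉ P.fluxPart → e k = 0) :
    ∀ k ∈ grid N, |e k| ≤ W * τ := by
  have hh := h_pos hl hN
  have h0 : ((0 : ℤ), (0 : ℤ)) ∈ grid N := ⟨le_rfl, by positivity, le_rfl, by positivity⟩
  -- The least multiple M w dominating |e| touches it at m. Comparing the scheme at the touching
  -- point gives M ≤ τ.
  obtain ⟨m, hm, hmax⟩ := (finite_grid N).exists_maximalFor (fun k => |e k| / w k) _ ⟨_, h0⟩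
  set M := |e m| / w m with hM
  replace hmax : ∀ k ∈ grid N, |e k| ≤ M * w k := fun k hk => by
    have : |e k| / w k ≤ M := le_of_not_gt fun h => absurd (hmax hk h.le) (not_le.2 h)
    rwa [div_le_iff₀ (hw k hk)] at this
  have hMm : |e m| = M * w m := by rw [hM, div_mul_cancel₀ _ (hw m hm).ne']
  have hM0 : 0 ≤ M := div_nonneg (abs_nonneg _) (hw m hm).le
  obtain ⟨ε, hε, hεm⟩ : ∃ ε : ℝ, |ε| = 1 ∧ ε * e m = M * w m := by
    rcases abs_choice (e m) with h | h
    · exact ⟨1, by norm_num, by rw [one_mul, ← h, hMm]⟩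
    · exact ⟨-1, by norm_num, by rw [neg_one_mul, ← h, hMm]⟩
  have hle : ∀ l ∈ grid N, (ε • e) l ≤ (M • w) l := by
    intro l hl
    refine (le_abs_self _).trans ?_
    rw [Pi.smul_apply, Pi.smul_apply, smul_eq_mul, smul_eq_mul, abs_mul, hε, one_mul]
    exact hmax l hl
  have habs : ∀ x : ℝ, -|x| ≤ ε * x := by
    intro x
    have := neg_abs_le (ε * x)
    rwa [abs_mul, hε, one_mul] at this
  have hMτ : M ≤ τ := by
    obtain hi | ⟨hi, hf⟩ | ⟨s, hs, hf⟩ := grid_cases hl hflux hN hm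
    · have h1 := interiorOp_mono hl hN hK hKh hle hi hεm
      rw [interiorOp_smul, interiorOp_smul] at h1
      have h2 := mul_le_mul_of_nonneg_left (hwi m hi) hM0
      linarith [habs (P.interiorOp N e m), hei m hi]
    · rw [hM, hed m hm hi hf]; simpa using hτ
    · have h1 := fluxLhs_mono hl hN hK hle hs hεm
      rw [fluxLhs_smul, fluxLhs_smul] at h1
      have h2 := mul_le_mul_of_nonneg_left (hwf s m hs hf) hM0
      have h3 : M / P.h N ≤ τ / P.h N := by
        rw [mul_div_assoc', mul_neg_one, neg_div] at h2
        linarith [habs (P.fluxLhs N s e m), hef s m hs hf]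
      exact (div_le_div_iff_of_pos_right hh).1 h3
  intro k hk
  calc |e k| ≤ M * w k := hmax k hk
    _ ≤ τ * W := mul_le_mul hMτ (hW k hk) (hw k hk).le hτ
    _ = W * τ := mul_comm _ _

/-- A positive function on the square with `Δw + K w ≤ -2` and `∂w/∂n + σ w ≥ 1` on the flux part. -/
structure IsBarrier (P : FluxProblem) (w : ℝ × ℝ → ℝ) : Prop where
  smooth : ContDiffOn ℝ (6 : ℕ) w P.domain
  pos : ∀ p ∈ P.domain, 0 < w p
  interior : ∀ p ∈ P.domain, P.laplacian w p + P.K * w p ≤ -2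
  flux : ∀ s, ∀ p ∈ P.openSide s, p ∈ P.fluxPart → 1 ≤ P.normalDeriv s w p + P.σ * w p

lemma Mh_add_smul (F G : ℤ × ℤ → ℝ) (c : ℝ) (k : ℤ × ℤ) :
    Mh (fun l => F l + c * G l) k = Mh F k + c * Mh G k := by
  simp only [Mh]; ring

/-- On fine grids, a barrier is a barrier for the finite difference equations. -/
lemma IsBarrier.exists_discrete (hl : 0 < P.len) (hK : P.K ≤ 0) {w : ℝ × ℝ → ℝ}
    (hw : P.IsBarrier w) : ∃ N₀ : ℕ, ∀ N, N₀ ≤ N → 1 ≤ N → |P.K| * P.h N ^ 2 ≤ 8 ∧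
      (∀ k ∈ interiorGrid N, P.interiorOp N (w ∘ P.node N) k ≤ -1) ∧
      (∀ s, ∀ k ∈ sideGrid N s, P.node N k ∈ P.fluxPart →
        P.fluxLhs N s (w ∘ P.node N) k ≤ -1 / P.h N) := by
  obtain ⟨M₆, hM₆⟩ := bddAbove_partialDeriv (m := 6) hl hw.smooth le_rfl
  obtain ⟨M₅, hM₅⟩ := bddAbove_partialDeriv (m := 5) hl hw.smooth (by norm_num)
  obtain ⟨M₃, hM₃⟩ := bddAbove_partialDeriv (m := 3) hl hw.smooth (by norm_num)
  obtain ⟨M₂, hM₂⟩ := bddAbove_partialDeriv (m := 2) hl hw.smooth (by norm_num)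
  obtain ⟨M₀, hM₀⟩ := bddAbove_partialDeriv (m := 0) hl hw.smooth (by norm_num)
  set Φ := 2 * M₂ + |P.K| * M₀ with hΦ
  have hΦb : ∀ p ∈ P.domain, |P.laplacian w p + P.K * w p| ≤ Φ := by
    intro p hp
    rw [laplacian_eq]
    have h1 := hM₂ p hp 2 0 rfl
    have h2 := hM₂ p hp 0 2 rfl
    have h3 := mul_le_mul_of_nonneg_left (hM₀ p hp 0 0 rfl) (abs_nonneg P.K)
    rw [← abs_mul] at h3
    have h4 := abs_add_three (P.partialDeriv w 2 0 p) (P.partialDeriv w 0 2 p) (P.K * w p)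
    refine h4.trans ?_
    change |P.K * w p| ≤ _ at h3
    linarith
  have htend : Filter.Tendsto (fun N : ℕ => P.h N) Filter.atTop (nhds 0) :=
    tendsto_const_div_atTop_nhds_zero_nat P.len
  have t1 : Filter.Tendsto (fun N : ℕ => |P.K| * P.h N ^ 2) Filter.atTop (nhds 0) := by
    simpa using (htend.pow 2).const_mul |P.K|
  have t2 : Filter.Tendsto (fun N : ℕ => 27 * M₆ * P.h N ^ 4) Filter.atTop (nhds 0) := by
    simpa using (htend.pow 4).const_mul (27 * M₆)
  have t3 : Filter.Tendsto (fun N : ℕ => P.h N * (8256 * (M₅ + |P.K| * M₃) * P.h N ^ 3 + 2 * Φ))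
      Filter.atTop (nhds 0) := by
    simpa using htend.mul (((htend.pow 3).const_mul (8256 * (M₅ + |P.K| * M₃))).add_const (2 * Φ))
  obtain ⟨N₀, hN₀⟩ := Filter.eventually_atTop.1 ((t1.eventually_le_const (by norm_num : (0 : ℝ) < 8)).and
    ((t2.eventually_le_const (by norm_num : (0 : ℝ) < 1)).and
      (t3.eventually_le_const (by norm_num : (0 : ℝ) < 1))))
  refine ⟨N₀, fun N hNN hN => ?_⟩
  obtain ⟨b1, b2, b3⟩ := hN₀ N hNN
  have hh := h_pos hl hN
  refine ⟨b1, fun k hk => ?_, fun s k hk hf => ?_⟩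
  · have h1 := abs_Lh_sub_Mh_laplacian_le hl hN hw.smooth hM₆ hk
    have h2 : Mh (fun l => (P.laplacian w ∘ P.node N) l + P.K * (w ∘ P.node N) l) k ≤ -2 := by
      obtain ⟨_, _, _, _, h5, h6, h7, h8, h9⟩ := ninePoints_mem_grid hk
      have i5 := hw.interior _ (node_mem_domain hl hN h5)
      have i6 := hw.interior _ (node_mem_domain hl hN h6)
      have i7 := hw.interior _ (node_mem_domain hl hN h7)
      have i8 := hw.interior _ (node_mem_domain hl hN h8)
      have i9 := hw.interior _ (node_mem_domain hl hN h9)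
      simp only [Mh, Function.comp]
      linarith
    rw [Mh_add_smul] at h2
    unfold interiorOp
    linarith [(abs_le.1 h1).2]
  · classical
    set g : ℝ × ℝ → ℝ := fun p => P.normalDeriv s w p + P.σ * w p with hg
    have hg1 : 1 ≤ g (P.node N k) := hw.flux s _ (node_mem_openSide hl hN hk) hf
    set f : ℤ × ℤ → ℝ := fun l => P.laplacian w (P.node N l) + P.K * w (P.node N l) with hf
    -- Only the one outside value next to k matters, so every outside value is set to the
    -- extrapolation at k; its defect is 0.
    set F : ℤ × ℤ → ℝ := fun l => if l ∈ grid N then f l else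
      3 * f k - 3 * f (k + s.inward) + f (k + s.inward + s.inward) with hF
    have hFg : ∀ l ∈ grid N, F l = f l := fun l hl => if_pos hl
    have hout : k - s.inward ∉ grid N := by
      rintro ⟨a, b, c, d⟩
      cases s <;> obtain ⟨h1, h2, h3⟩ := hk <;> simp [SquareSide.inward] at a b c d <;> omega
    obtain ⟨h1, h2, h3, h4, h5, h6⟩ := sixPoints_mem_grid hk
    have h7 : k + s.inward + s.inward ∈ grid N := by
      have := mem_grid_of_mem_sideGrid hk (a := 2) (b := 0) (by norm_num) le_rfl (by norm_num)
      convert this using 1; module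
    have hFout : F (k - s.inward) = 3 * f k - 3 * f (k + s.inward) + f (k + s.inward + s.inward) :=
      if_neg hout
    have hcons := abs_fluxLhs_sub_fluxRhs_le hl hK hN (hw.smooth.of_le (by norm_cast)) hM₅ hM₃ hk
      (F := F) (g := g) (δ := 0) hFg (by
        rw [hFout, hFg _ h3, hFg _ h4, hFg _ h7]; simp) rfl
    have h12 := twelve_le_lam hK N
    have hlam : P.lam N = 12 - P.K * P.h N ^ 2 := rfl
    have hlpos : 0 < P.lam N := by linarith
    have hκ : 0 ≤ - P.K * P.h N ^ 2 := mul_nonneg (by linarith) (by positivity)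
    have hΦ0 : 0 ≤ Φ := (abs_nonneg _).trans (hΦb _ (node_mem_domain hl hN h3))
    have B : ∀ l ∈ grid N, |f l| ≤ Φ := fun l hl' => hΦb _ (node_mem_domain hl hN hl')
    -- After the outside value is expanded, the absolute weights add up to 14 - Kh² ≤ 2λ.
    have r1 : 1 / P.lam N * (F (k + s.tangent) - F (k - s.inward) + (8 - P.K * P.h N ^ 2) * F k
        + 3 * F (k + s.inward) + F (k - s.tangent)) ≤ 2 * Φ := by
      rw [hFout, hFg _ h1, hFg _ h3, hFg _ h4, hFg _ h5, one_div, inv_mul_le_iff₀ hlpos]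
      have b1 := abs_le.1 (B _ h1)
      have b3 := abs_le.1 (B _ h3)
      have b4 := abs_le.1 (B _ h4)
      have b5 := abs_le.1 (B _ h5)
      have b7 := abs_le.1 (B _ h7)
      have := mul_le_mul_of_nonneg_left b3.2 hκ
      have := mul_nonneg hκ hΦ0
      rw [hlam]
      nlinarith
    -- Since 24 - 4Kh² ≥ 2λ, flux data at least 1 contribute at most -2/h. Half of this absorbs the
    -- source term and the truncation error.
    have r2 : (4 * P.K * P.h N ^ 2 - 24) / (P.lam N * P.h N) * g (P.node N k) ≤ - 2 / P.h N := by
      have h8 : (4 * P.K * P.h N ^ 2 - 24) / (P.lam N * P.h N) ≤ -2 / P.h N := by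
        rw [div_le_div_iff₀ (by positivity) hh, hlam]
        nlinarith
      have h9 : -2 / P.h N ≤ 0 := div_nonpos_of_nonpos_of_nonneg (by norm_num) hh.le
      nlinarith
    have h10 : P.fluxRhs N s F g k ≤ 2 * Φ - 2 / P.h N := by
      unfold fluxRhs
      rw [neg_div] at r2
      linarith
    have h11 : 8256 * (M₅ + |P.K| * M₃) * P.h N ^ 3 + 2 * Φ ≤ 1 / P.h N := by
      rw [le_div_iff₀ hh]; linarith
    have h13 : 2 / P.h N = 1 / P.h N + 1 / P.h N := by ring
    rw [neg_div]
    linarith [(abs_le.1 hcons).2]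

/-- Stability of the scheme, uniformly in the mesh size. -/
lemma IsBarrier.exists_stability (hl : 0 < P.len) (hflux : P.fluxPart ⊆ ⋃ s, P.openSide s)
    (hK : P.K ≤ 0) (hσ : 0 ≤ P.σ) {w : ℝ × ℝ → ℝ} (hw : P.IsBarrier w) :
    ∃ C : ℝ, 0 ≤ C ∧ ∀ N, 1 ≤ N → ∀ (e : ℤ × ℤ → ℝ) (τ : ℝ), 0 ≤ τ →
      (∀ k ∈ interiorGrid N, |P.interiorOp N e k| ≤ τ) →
      (∀ s, ∀ k ∈ sideGrid N s, P.node N k ∈ P.fluxPart → |P.fluxLhs N s e k| ≤ τ / P.h N) →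
      (∀ k ∈ grid N, k ∉ interiorGrid N → P.node N k ∉ P.fluxPart → e k = 0) →
      ∀ k ∈ grid N, |e k| ≤ C * τ := by
  obtain ⟨N₀, hN₀⟩ := hw.exists_discrete hl hK
  obtain ⟨W, hW⟩ := isCompact_domain.exists_bound_of_continuousOn hw.smooth.continuousOn
  have hfix : ∀ N : ℕ, ∃ C : ℝ, 0 ≤ C ∧ (1 ≤ N → ∀ (e : ℤ × ℤ → ℝ) (τ : ℝ),
      (∀ k ∈ grid N, |P.schemeOp N e k| ≤ τ) → ∀ k ∈ grid N, |e k| ≤ C * τ) := by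
    intro N
    by_cases hN : 1 ≤ N
    · obtain ⟨C, h0, hC⟩ := exists_abs_le_mul_of_abs_schemeOp_le hl hflux hK hσ hN
      exact ⟨C, h0, fun _ => hC⟩
    · exact ⟨0, le_rfl, fun h => absurd h hN⟩
  choose c hc0 hc using hfix
  have hsum0 : 0 ≤ ∑ n ∈ Finset.range N₀, c n * max 1 (1 / P.h n) :=
    Finset.sum_nonneg fun n _ => mul_nonneg (hc0 n) (zero_le_one.trans (le_max_left _ _))
  -- On a coarse grid flux rows are controlled only by τ/h, hence the factor max 1 (1/h). The sum
  -- dominates each of its finitely many terms; at n = 0 division by zero gives 1/h = 0, which is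
  -- harmless.
  refine ⟨|W| + ∑ n ∈ Finset.range N₀, c n * max 1 (1 / P.h n), by positivity, ?_⟩
  intro N hN e τ hτ hei hef hed k hk
  have hh := h_pos hl hN
  rcases le_or_gt N₀ N with hNN | hNN
  · obtain ⟨h1, h2, h3⟩ := hN₀ N hNN hN
    have h4 := abs_le_of_barrier hl hflux hK hN h1 (w := w ∘ P.node N) (W := |W|)
      (fun k hk => hw.pos _ (node_mem_domain hl hN hk))
      (fun k hk => (le_abs_self _).trans ((hW _ (node_mem_domain hl hN hk)).trans (le_abs_self _)))
      h2 h3 hτ hei hef hed k hk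
    nlinarith
  · have h1 : ∀ k ∈ grid N, |P.schemeOp N e k| ≤ τ * max 1 (1 / P.h N) := by
      intro k hk
      obtain hi | ⟨hi, hf⟩ | ⟨s, hs, hf⟩ := grid_cases hl hflux hN hk
      · rw [schemeOp_interior hi]
        exact (hei k hi).trans (le_mul_of_one_le_right hτ (le_max_left _ _))
      · rw [schemeOp_dirichlet hi hf, hed k hk hi hf, abs_zero]
        positivity
      · rw [schemeOp_flux hs hf]
        refine (hef s k hs hf).trans ?_
        rw [div_eq_mul_one_div]
        gcongr
        exact le_max_right _ _
    have h2 := hc N hN e _ h1 k hk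
    have h3 : c N * max 1 (1 / P.h N) ≤ ∑ n ∈ Finset.range N₀, c n * max 1 (1 / P.h n) :=
      Finset.single_le_sum (f := fun n => c n * max 1 (1 / P.h n))
        (fun n _ => mul_nonneg (hc0 n) (zero_le_one.trans (le_max_left _ _)))
        (Finset.mem_range.2 hNN)
    calc |e k| ≤ c N * max 1 (1 / P.h N) * τ := by linarith
      _ ≤ _ := by
        gcongr
        linarith [abs_nonneg W]

end Stability

/-! ### Construction of barriers -/

section Barrier

variable {P : FluxProblem}

lemma hasDerivAt_barrier (c β a y A q z : ℝ) {s : ℝ} (h : (s - q) ^ 2 + z ≠ 0) :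
    HasDerivAt (fun s => c + β * ((s - a) ^ 2 + y) - A / ((s - q) ^ 2 + z))
      (2 * β * (s - a) + 2 * A * (s - q) / ((s - q) ^ 2 + z) ^ 2) s := by
  have h1 := ((hasDerivAt_id s).sub_const a).pow 2
  have h2 := (((hasDerivAt_id s).sub_const q).pow 2).add_const z
  have h3 := (((h1.add_const y).const_mul β).const_add c).sub ((hasDerivAt_const s A).div h2 h)
  refine h3.congr_deriv ?_
  simp
  field_simp
  ring

lemma hasDerivAt_deriv_barrier (β a A q z : ℝ) {s : ℝ} (h : (s - q) ^ 2 + z ≠ 0) :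
    HasDerivAt (fun s => 2 * β * (s - a) + 2 * A * (s - q) / ((s - q) ^ 2 + z) ^ 2)
      (2 * β + 2 * A / ((s - q) ^ 2 + z) ^ 2 - 8 * A * (s - q) ^ 2 / ((s - q) ^ 2 + z) ^ 3) s := by
  have h1 := ((hasDerivAt_id s).sub_const a).const_mul (2 * β)
  have h2 := ((((hasDerivAt_id s).sub_const q).pow 2).add_const z).pow 2
  have h4 := ((hasDerivAt_id s).sub_const q).const_mul (2 * A)
  have h3 := h1.add (h4.div h2 (pow_ne_zero 2 h))
  refine h3.congr_deriv ?_
  simp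
  field_simp
  ring

/-- The function `c + β |p - m|² - A / |p - q|²`, where `m` is the centre of the square. -/
noncomputable def barrier (P : FluxProblem) (c β A : ℝ) (q : ℝ × ℝ) : ℝ × ℝ → ℝ := fun p =>
  c + β * ((p.1 - (P.xl + P.len / 2)) ^ 2 + (p.2 - (P.yl + P.len / 2)) ^ 2)
    - A / ((p.1 - q.1) ^ 2 + (p.2 - q.2) ^ 2)

variable {c β A : ℝ} {q p : ℝ × ℝ}

lemma dx_barrier (hl : 0 < P.len) (hq : ∀ p ∈ P.domain, (p.1 - q.1) ^ 2 + (p.2 - q.2) ^ 2 ≠ 0) :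
    Set.EqOn (P.dx (P.barrier c β A q)) (fun p => 2 * β * (p.1 - (P.xl + P.len / 2))
      + 2 * A * (p.1 - q.1) / ((p.1 - q.1) ^ 2 + (p.2 - q.2) ^ 2) ^ 2) P.domain := fun p hp =>
  (hasDerivAt_barrier c β (P.xl + P.len / 2) ((p.2 - (P.yl + P.len / 2)) ^ 2) A q.1 _ (hq p hp)).hasDerivWithinAt.derivWithin
    (uniqueDiffOn_Icc (by linarith) _ hp.1)

lemma dy_barrier (hl : 0 < P.len) (hq : ∀ p ∈ P.domain, (p.1 - q.1) ^ 2 + (p.2 - q.2) ^ 2 ≠ 0) :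
    Set.EqOn (P.dy (P.barrier c β A q)) (fun p => 2 * β * (p.2 - (P.yl + P.len / 2))
      + 2 * A * (p.2 - q.2) / ((p.1 - q.1) ^ 2 + (p.2 - q.2) ^ 2) ^ 2) P.domain := by
  intro p hp
  have h1 := hasDerivAt_barrier c β (P.yl + P.len / 2) ((p.1 - (P.xl + P.len / 2)) ^ 2) A q.2
    ((p.1 - q.1) ^ 2) (s := p.2) (by rw [add_comm]; exact hq p hp)
  have h2 := h1.hasDerivWithinAt.derivWithin (s := P.yInterval)
    (uniqueDiffOn_Icc (by linarith) _ hp.2)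
  simp only [add_comm _ ((p.1 - (P.xl + P.len / 2)) ^ 2), add_comm _ ((p.1 - q.1) ^ 2)] at h2
  exact h2

/-- In the plane Δ|p|⁻² = 4|p|⁻⁴, so -A/|p - q|² with A > 0 is strictly superharmonic away from its
pole and can offset the paraboloid. -/
lemma laplacian_barrier (hl : 0 < P.len)
    (hq : ∀ p ∈ P.domain, (p.1 - q.1) ^ 2 + (p.2 - q.2) ^ 2 ≠ 0) (hp : p ∈ P.domain) :
    P.laplacian (P.barrier c β A q) p
      = 4 * β - 4 * A / ((p.1 - q.1) ^ 2 + (p.2 - q.2) ^ 2) ^ 2 := by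
  have hx : P.dx (P.dx (P.barrier c β A q)) p = 2 * β
      + 2 * A / ((p.1 - q.1) ^ 2 + (p.2 - q.2) ^ 2) ^ 2
      - 8 * A * (p.1 - q.1) ^ 2 / ((p.1 - q.1) ^ 2 + (p.2 - q.2) ^ 2) ^ 3 := by
    rw [dx_congr (dx_barrier hl hq) hp]
    exact (hasDerivAt_deriv_barrier β _ A q.1 _ (hq p hp)).hasDerivWithinAt.derivWithin
      (uniqueDiffOn_Icc (by linarith) _ hp.1)
  have hy : P.dy (P.dy (P.barrier c β A q)) p = 2 * β
      + 2 * A / ((p.1 - q.1) ^ 2 + (p.2 - q.2) ^ 2) ^ 2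
      - 8 * A * (p.2 - q.2) ^ 2 / ((p.1 - q.1) ^ 2 + (p.2 - q.2) ^ 2) ^ 3 := by
    rw [dy_congr (dy_barrier hl hq) hp]
    have h1 := hasDerivAt_deriv_barrier β (P.yl + P.len / 2) A q.2
      ((p.1 - q.1) ^ 2) (s := p.2) (by rw [add_comm]; exact hq p hp)
    have h2 := h1.hasDerivWithinAt.derivWithin (s := P.yInterval)
      (uniqueDiffOn_Icc (by linarith) _ hp.2)
    simp only [add_comm _ ((p.1 - q.1) ^ 2)] at h2
    exact h2
  have := hq p hp
  rw [laplacian, hx, hy]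
  field_simp
  ring

lemma contDiffOn_barrier (hq : ∀ p ∈ P.domain, (p.1 - q.1) ^ 2 + (p.2 - q.2) ^ 2 ≠ 0) (n : ℕ) :
    ContDiffOn ℝ n (P.barrier c β A q) P.domain := by
  unfold barrier
  refine ContDiffOn.sub (by fun_prop) (ContDiffOn.div contDiffOn_const (by fun_prop) hq)

lemma openSide_subset_bdry (s : SquareSide) (hl : 0 < P.len) : P.openSide s ⊆ P.bdry := by
  intro p hp
  cases s <;> obtain ⟨h1, h2⟩ := hp
  · exact ⟨⟨⟨h1.ge, by linarith⟩, ⟨h2.1.le, h2.2.le⟩⟩, Or.inl h1⟩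
  · exact ⟨⟨⟨by linarith, h1.le⟩, ⟨h2.1.le, h2.2.le⟩⟩, Or.inr (Or.inl h1)⟩
  · exact ⟨⟨⟨h1.1.le, h1.2.le⟩, ⟨h2.ge, by linarith⟩⟩, Or.inr (Or.inr (Or.inl h2))⟩
  · exact ⟨⟨⟨h1.1.le, h1.2.le⟩, ⟨by linarith, h2.le⟩⟩, Or.inr (Or.inr (Or.inr h2))⟩

/-- The outward normal component of a vector. -/
def normalComp (s : SquareSide) (v : ℝ × ℝ) : ℝ :=
  -((s.inward.1 : ℝ) * v.1 + (s.inward.2 : ℝ) * v.2)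

/-- Each side lies at distance len/2 from the centre, so the paraboloid has the constant outward
slope β·len. -/
lemma normalDeriv_barrier (hl : 0 < P.len)
    (hq : ∀ p ∈ P.domain, (p.1 - q.1) ^ 2 + (p.2 - q.2) ^ 2 ≠ 0) {s : SquareSide}
    (hp : p ∈ P.openSide s) : P.normalDeriv s (P.barrier c β A q) p
      = β * P.len + 2 * A * normalComp s (p - q) / ((p.1 - q.1) ^ 2 + (p.2 - q.2) ^ 2) ^ 2 := by
  have hd := (openSide_subset_bdry s hl hp).1
  rw [normalDeriv, dx_barrier hl hq hd, dy_barrier hl hq hd]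
  have hm : normalComp s (p - (P.xl + P.len / 2, P.yl + P.len / 2)) = P.len / 2 := by
    cases s <;> obtain ⟨h1, h2⟩ := hp <;> simp [normalComp, SquareSide.inward, h1, h2] <;> ring
  simp only [normalComp, Prod.fst_sub, Prod.snd_sub] at hm ⊢
  linear_combination 2 * β * hm

lemma sq_sub_center_le {a x : ℝ} (hx : x ∈ Set.Icc a (a + P.len)) :
    (x - (a + P.len / 2)) ^ 2 ≤ P.len ^ 2 / 4 := by
  nlinarith [hx.1, hx.2, mul_nonneg (sub_nonneg.2 hx.1) (sub_nonneg.2 hx.2)]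

/-- The zeroth order term suffices: β = 1/len gives outward slope 1, and c is chosen with Kc = -(2 +
4β), which absorbs the Laplacian 4β. The pole has strength A = 0 and sits anywhere off the square.
-/
lemma exists_isBarrier_of_neg (hl : 0 < P.len) (hK : P.K < 0) (hσ : 0 ≤ P.σ) :
    ∃ w, P.IsBarrier w := by
  have hq : ∀ p ∈ P.domain, (p.1 - (P.xl - 1, P.yl).1) ^ 2 + (p.2 - (P.xl - 1, P.yl).2) ^ 2 ≠ 0 := by
    intro p hp
    have : 1 ≤ p.1 - (P.xl - 1) := by linarith [hp.1.1]
    have h2 := sq_nonneg (p.2 - P.yl)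
    simp only
    nlinarith
  have hc : 0 < (2 + 4 * (1 / P.len)) / -P.K := div_pos (by positivity) (by linarith)
  have hge : ∀ p, (2 + 4 * (1 / P.len)) / -P.K ≤
      P.barrier ((2 + 4 * (1 / P.len)) / -P.K) (1 / P.len) 0 (P.xl - 1, P.yl) p := by
    intro p
    unfold barrier
    rw [zero_div, sub_zero]
    exact le_add_of_nonneg_right (by positivity)
  refine ⟨_, contDiffOn_barrier hq 6, fun p _ => hc.trans_le (hge p), fun p hp => ?_,
    fun s p hp _ => ?_⟩
  · rw [laplacian_barrier hl hq hp]
    have h1 := mul_le_mul_of_nonpos_left (hge p) hK.le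
    have h2 : P.K * ((2 + 4 * (1 / P.len)) / -P.K) = -(2 + 4 * (1 / P.len)) := by
      rw [div_neg, mul_neg, mul_div_cancel₀ _ hK.ne]
    rw [h2] at h1
    simp only [mul_zero, zero_div, sub_zero]
    linarith
  · rw [normalDeriv_barrier hl hq hp]
    have h1 := mul_nonneg hσ (hc.le.trans (hge p))
    have h2 : 1 / P.len * P.len = 1 := by field_simp
    rw [h2]
    simp only [mul_zero, zero_mul, zero_div]
    linarith

/-- The concave paraboloid β = -1 has Laplacian -4 and outward slope -len. As |p - m|² ≤ len²/2, the
constant keeps w ≥ (len + 1)/σ, so σw outweighs the slope by 1. -/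
lemma exists_isBarrier_of_pos (hl : 0 < P.len) (hK : P.K ≤ 0) (hσ : 0 < P.σ) :
    ∃ w, P.IsBarrier w := by
  have hq : ∀ p ∈ P.domain, (p.1 - (P.xl - 1, P.yl).1) ^ 2 + (p.2 - (P.xl - 1, P.yl).2) ^ 2 ≠ 0 := by
    intro p hp
    have : 1 ≤ p.1 - (P.xl - 1) := by linarith [hp.1.1]
    have h2 := sq_nonneg (p.2 - P.yl)
    simp only
    nlinarith
  have hc : 0 < (P.len + 1) / P.σ := by positivity
  have hge : ∀ p ∈ P.domain, (P.len + 1) / P.σ ≤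
      P.barrier (P.len ^ 2 / 2 + (P.len + 1) / P.σ) (-1) 0 (P.xl - 1, P.yl) p := by
    intro p hp
    unfold barrier
    have h1 := sq_sub_center_le hp.1
    have h2 := sq_sub_center_le hp.2
    rw [zero_div, sub_zero]
    linarith
  refine ⟨_, contDiffOn_barrier hq 6, fun p hp => hc.trans_le (hge p hp), fun p hp => ?_,
    fun s p hp _ => ?_⟩
  · rw [laplacian_barrier hl hq hp]
    have h1 := mul_nonpos_of_nonpos_of_nonneg hK (hc.le.trans (hge p hp))
    simp only [mul_zero, zero_div, sub_zero]
    linarith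
  · rw [normalDeriv_barrier hl hq hp]
    have h1 := mul_le_mul_of_nonneg_left (hge p (openSide_subset_bdry s hl hp).1) hσ.le
    rw [mul_div_cancel₀ _ hσ.ne'] at h1
    simp only [mul_zero, zero_mul, zero_div]
    linarith

/-- If K = σ = 0, the divergence theorem forces a large negative flux of w through the Dirichlet
part. A pole q just outside the square, next to a point with a Dirichlet neighbourhood, provides it.
On flux sides the pole does little harm: q is at most ηlen/2 beyond the line of any side and stays
away from the flux part. -/
lemma exists_isBarrier_of_hasDirichletSegment (hl : 0 < P.len) (hK : P.K ≤ 0) (hσ : 0 ≤ P.σ)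
    (hseg : P.HasDirichletSegment) : ∃ w, P.IsBarrier w := by
  obtain ⟨⟨a, b⟩, hp, ε, hε, hdir⟩ := hseg
  set m₁ := P.xl + P.len / 2 with hm₁
  set m₂ := P.yl + P.len / 2 with hm₂
  have habs : ∀ x ∈ P.xInterval, |x - m₁| ≤ P.len / 2 := fun x hx =>
    abs_le.2 ⟨by linarith [hx.1], by linarith [hx.2]⟩
  have habs' : ∀ y ∈ P.yInterval, |y - m₂| ≤ P.len / 2 := fun y hy =>
    abs_le.2 ⟨by linarith [hy.1], by linarith [hy.2]⟩
  have ha := habs a hp.1.1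
  have hb := habs' b hp.1.2
  -- A can be fixed before η because |p - q|² ≤ 5 len² for all η ≤ 1; then 4A/|p - q|⁴ ≥ 2 + 8/len,
  -- where 8/len is the Laplacian of the paraboloid with β = 2/len.
  set A := (2 + 8 / P.len) * (5 * P.len ^ 2) ^ 2 / 4 with hA
  have hApos : 0 < A := by positivity
  -- The bound ε/len keeps each coordinate of q within ε/2 of (a, b), so |p - q| ≥ ε/2 on the flux
  -- part. The last bound then keeps the pole's normal derivative above -1, against the slope 2 of
  -- the paraboloid.
  obtain ⟨η, hη, hη1, hη2, hη3⟩ : ∃ η : ℝ, 0 < η ∧ η ≤ 1 ∧ η ≤ ε / P.len ∧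
      η ≤ ε ^ 4 / (16 * A * P.len) :=
    ⟨min 1 (min (ε / P.len) (ε ^ 4 / (16 * A * P.len))), by positivity, min_le_left _ _,
      (min_le_right _ _).trans (min_le_left _ _), (min_le_right _ _).trans (min_le_right _ _)⟩
  set q : ℝ × ℝ := (m₁ + (1 + η) * (a - m₁), m₂ + (1 + η) * (b - m₂)) with hq
  have hδ : 0 < η * P.len / 2 := by positivity
  -- one coordinate of `q` lies outside of the square
  have hRmin : ∀ p ∈ P.domain, (η * P.len / 2) ^ 2 ≤ (p.1 - q.1) ^ 2 + (p.2 - q.2) ^ 2 := by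
    intro p hpd
    have h1 := abs_le.1 (habs p.1 hpd.1)
    have h2 := abs_le.1 (habs' p.2 hpd.2)
    have s1 := sq_nonneg (p.1 - q.1)
    have s2 := sq_nonneg (p.2 - q.2)
    have hcase : η * P.len / 2 ≤ |p.1 - q.1| ∨ η * P.len / 2 ≤ |p.2 - q.2| := by
      rcases hp.2 with h | h | h | h
      · left; rw [le_abs]; left
        have : a - m₁ = - (P.len / 2) := by rw [hm₁]; simp only at h; linarith
        simp only [hq, this]; linarith
      · left; rw [le_abs]; right
        have : a - m₁ = P.len / 2 := by rw [hm₁]; simp only at h; linarith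
        simp only [hq, this]; linarith
      · right; rw [le_abs]; left
        have : b - m₂ = - (P.len / 2) := by rw [hm₂]; simp only at h; linarith
        simp only [hq, this]; linarith
      · right; rw [le_abs]; right
        have : b - m₂ = P.len / 2 := by rw [hm₂]; simp only at h; linarith
        simp only [hq, this]; linarith
    rcases hcase with h | h
    · have := pow_le_pow_left₀ hδ.le h 2
      rw [sq_abs] at this; linarith
    · have := pow_le_pow_left₀ hδ.le h 2
      rw [sq_abs] at this; linarith
  have hRmax : ∀ p ∈ P.domain, (p.1 - q.1) ^ 2 + (p.2 - q.2) ^ 2 ≤ 5 * P.len ^ 2 := by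
    intro p hpd
    have key : ∀ x m a : ℝ, |x - m| ≤ P.len / 2 → |a - m| ≤ P.len / 2 →
        (x - (m + (1 + η) * (a - m))) ^ 2 ≤ 9 / 4 * P.len ^ 2 := by
      intro x m a h1 h2
      have h3 : |x - (m + (1 + η) * (a - m))| ≤ 3 / 2 * P.len := by
        have h4 : |(1 + η) * (a - m)| ≤ 2 * (P.len / 2) := by
          rw [abs_mul, abs_of_pos (by linarith : (0 : ℝ) < 1 + η)]
          gcongr; linarith
        rw [abs_le] at *
        constructor <;> linarith
      have := pow_le_pow_left₀ (abs_nonneg _) h3 2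
      rw [sq_abs] at this
      linarith
    have k1 := key p.1 m₁ a (habs _ hpd.1) ha
    have k2 := key p.2 m₂ b (habs' _ hpd.2) hb
    simp only [hq]
    nlinarith
  have hR0 : ∀ p ∈ P.domain, 0 < (p.1 - q.1) ^ 2 + (p.2 - q.2) ^ 2 := fun p hpd =>
    lt_of_lt_of_le (by positivity) (hRmin p hpd)
  have hne : ∀ p ∈ P.domain, (p.1 - q.1) ^ 2 + (p.2 - q.2) ^ 2 ≠ 0 := fun p hpd => (hR0 p hpd).ne'
  have hpos : ∀ p ∈ P.domain, 0 < P.barrier (A / (η * P.len / 2) ^ 2 + 1) (2 / P.len) A q p := by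
    intro p hpd
    have h1 : A / ((p.1 - q.1) ^ 2 + (p.2 - q.2) ^ 2) ≤ A / (η * P.len / 2) ^ 2 :=
      div_le_div_of_nonneg_left hApos.le (by positivity) (hRmin p hpd)
    have h2 : 0 ≤ 2 / P.len * ((p.1 - m₁) ^ 2 + (p.2 - m₂) ^ 2) := by positivity
    rw [barrier, ← hm₁, ← hm₂]
    linarith
  refine ⟨_, contDiffOn_barrier hne 6, hpos, fun p hpd => ?_, fun s p hps hpf => ?_⟩
  · rw [laplacian_barrier hl hne hpd]
    have h1 := mul_nonpos_of_nonpos_of_nonneg hK (hpos p hpd).le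
    have h2 : 2 + 8 / P.len ≤ 4 * A / ((p.1 - q.1) ^ 2 + (p.2 - q.2) ^ 2) ^ 2 := by
      rw [le_div_iff₀ (pow_pos (hR0 p hpd) 2)]
      have h3 := pow_le_pow_left₀ (hR0 p hpd).le (hRmax p hpd) 2
      have h4 := mul_le_mul_of_nonneg_left h3 (by positivity : 0 ≤ 2 + 8 / P.len)
      rw [hA]; linarith
    have h5 : 4 * (2 / P.len) = 8 / P.len := by ring
    linarith
  · have hpb := openSide_subset_bdry s hl hps
    rw [normalDeriv_barrier hl hne hps]
    have h1 := mul_nonneg hσ (hpos p hpb.1).le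
    have h2 : 2 / P.len * P.len = 2 := by field_simp
    have hfar : ε ≤ dist p (a, b) := le_of_not_gt fun h => hdir p hpb h hpf
    have hηε : η * P.len / 2 ≤ ε / 2 := by
      rw [le_div_iff₀ hl] at hη2; linarith
    have hnear : ∀ x m a : ℝ, |a - m| ≤ P.len / 2 → ε ≤ |x - a| →
        ε ^ 2 / 4 ≤ (x - (m + (1 + η) * (a - m))) ^ 2 := by
      intro x m a h3 h4
      have h5 : ε / 2 ≤ |x - (m + (1 + η) * (a - m))| := by
        have h6 : |x - a| ≤ |x - (m + (1 + η) * (a - m))| + |η * (a - m)| := by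
          have : x - a = (x - (m + (1 + η) * (a - m))) + η * (a - m) := by ring
          rw [this]
          exact abs_add_le _ _
        have h7 : |η * (a - m)| ≤ η * (P.len / 2) := by
          rw [abs_mul, abs_of_pos hη]; gcongr
        linarith
      have := pow_le_pow_left₀ (by positivity) h5 2
      rw [sq_abs] at this
      linarith
    have hR : ε ^ 2 / 4 ≤ (p.1 - q.1) ^ 2 + (p.2 - q.2) ^ 2 := by
      rw [Prod.dist_eq, le_max_iff, Real.dist_eq, Real.dist_eq] at hfar
      rcases hfar with h | h
      · have := hnear _ m₁ _ ha h
        have := sq_nonneg (p.2 - q.2)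
        simp only [hq] at *; linarith
      · have := hnear _ m₂ _ hb h
        have := sq_nonneg (p.1 - q.1)
        simp only [hq] at *; linarith
    have hn : -(η * P.len / 2) ≤ normalComp s (p - q) := by
      have e1 : (1 + η) * |a - m₁| ≤ (1 + η) * (P.len / 2) := by gcongr
      have e2 : (1 + η) * |b - m₂| ≤ (1 + η) * (P.len / 2) := by gcongr
      have e3 := mul_le_mul_of_nonneg_left (le_abs_self (a - m₁)) (by linarith : 0 ≤ 1 + η)
      have e4 := mul_le_mul_of_nonneg_left (le_abs_self (b - m₂)) (by linarith : 0 ≤ 1 + η)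
      have e5 := mul_le_mul_of_nonneg_left (neg_abs_le (a - m₁)) (by linarith : 0 ≤ 1 + η)
      have e6 := mul_le_mul_of_nonneg_left (neg_abs_le (b - m₂)) (by linarith : 0 ≤ 1 + η)
      cases s <;> obtain ⟨h3, h4⟩ := hps <;>
        simp only [normalComp, SquareSide.inward, hq, Prod.fst_sub, Prod.snd_sub] <;>
        push_cast <;> first | rw [h3] | rw [h4]
      all_goals linarith
    have h3 : -1 ≤ 2 * A * normalComp s (p - q) / ((p.1 - q.1) ^ 2 + (p.2 - q.2) ^ 2) ^ 2 := by
      rw [le_div_iff₀ (pow_pos (hR0 p hpb.1) 2)]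
      have h4 := pow_le_pow_left₀ (by positivity) hR 2
      have h5 := mul_le_mul_of_nonneg_left hn (by positivity : 0 ≤ 2 * A)
      rw [le_div_iff₀ (by positivity)] at hη3
      have h6 : (ε ^ 2 / 4) ^ 2 = ε ^ 4 / 16 := by ring
      have h7 : 2 * A * -(η * P.len / 2) = -(η * (16 * A * P.len)) / 16 := by ring
      rw [h6] at h4
      rw [h7] at h5
      generalize ((p.1 - q.1) ^ 2 + (p.2 - q.2) ^ 2) ^ 2 = R at *
      linarith
    linarith

lemma exists_isBarrier (hl : 0 < P.len) (hK : P.K ≤ 0) (hσ : 0 ≤ P.σ)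
    (hseg : P.K = 0 → P.σ = 0 → P.HasDirichletSegment) : ∃ w, P.IsBarrier w := by
  rcases hK.lt_or_eq with hK' | hK'
  · exact exists_isBarrier_of_neg hl hK' hσ
  · rcases hσ.lt_or_eq with hσ' | hσ'
    · exact exists_isBarrier_of_pos hl hK hσ'
    · exact exists_isBarrier_of_hasDirichletSegment hl hK hσ (hseg hK' hσ'.symm)

end Barrier

/-! ### Polynomial solutions -/

section Polynomial

open MvPolynomial

variable {P : FluxProblem}

/-- Vanishing coefficients from degree n on, rather than a bound on `totalDegree`, can be iterated
down to n = 0, where the condition says that the polynomial is zero. -/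
lemma coeff_pderiv_eq_zero {n : ℕ} {Q : MvPolynomial (Fin 2) ℝ}
    (hQ : ∀ m : Fin 2 →₀ ℕ, n + 1 ≤ m.degree → Q.coeff m = 0) (i : Fin 2) :
    ∀ m : Fin 2 →₀ ℕ, n ≤ m.degree → (pderiv i Q).coeff m = 0 := by
  intro m hm
  rw [coeff_pderiv, hQ _ (by simpa [map_add] using hm), zero_mul]

lemma coeff_pderiv_iterate_eq_zero {n l : ℕ} {Q : MvPolynomial (Fin 2) ℝ}
    (hQ : ∀ m : Fin 2 →₀ ℕ, n + l ≤ m.degree → Q.coeff m = 0) (i : Fin 2) :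
    ∀ m : Fin 2 →₀ ℕ, n ≤ m.degree → ((pderiv i)^[l] Q).coeff m = 0 := by
  induction l generalizing n with
  | zero => exact hQ
  | succ l ih =>
    rw [Function.iterate_succ_apply']
    exact coeff_pderiv_eq_zero (ih (by simpa [add_assoc, add_comm 1] using hQ)) i

lemma hasDerivAt_eval_fst (Q : MvPolynomial (Fin 2) ℝ) (x y : ℝ) :
    HasDerivAt (fun s => eval ![s, y] Q) (eval ![x, y] (pderiv 0 Q)) x := by
  induction Q using MvPolynomial.induction_on with
  | C a => simpa using hasDerivAt_const x a
  | add p q hp hq => simpa using hp.fun_add hq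
  | mul_X p i hp =>
    rw [pderiv_mul]
    fin_cases i
    · simpa using hp.fun_mul (hasDerivAt_id' x)
    · simpa [pderiv_X_of_ne] using hp.mul_const y

lemma hasDerivAt_eval_snd (Q : MvPolynomial (Fin 2) ℝ) (x y : ℝ) :
    HasDerivAt (fun t => eval ![x, t] Q) (eval ![x, y] (pderiv 1 Q)) y := by
  induction Q using MvPolynomial.induction_on with
  | C a => simpa using hasDerivAt_const y a
  | add p q hp hq => simpa using hp.fun_add hq
  | mul_X p i hp =>
    rw [pderiv_mul]
    fin_cases i
    · simpa [pderiv_X_of_ne] using hp.mul_const x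
    · simpa using hp.fun_mul (hasDerivAt_id' y)

lemma dx_iterate_eval (hl : 0 < P.len) (Q : MvPolynomial (Fin 2) ℝ) (i : ℕ) :
    Set.EqOn (P.dx^[i] fun p => eval ![p.1, p.2] Q)
      (fun p => eval ![p.1, p.2] ((pderiv 0)^[i] Q)) P.domain := by
  induction i with
  | zero => exact fun _ _ => rfl
  | succ i ih =>
    rw [Function.iterate_succ_apply', Function.iterate_succ_apply']
    refine (dx_congr ih).trans fun p hp => ?_
    exact (hasDerivAt_eval_fst _ _ _).hasDerivWithinAt.derivWithin
      (uniqueDiffOn_Icc (by linarith) _ hp.1)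

lemma dy_iterate_eval (hl : 0 < P.len) (Q : MvPolynomial (Fin 2) ℝ) (j : ℕ) :
    Set.EqOn (P.dy^[j] fun p => eval ![p.1, p.2] Q)
      (fun p => eval ![p.1, p.2] ((pderiv 1)^[j] Q)) P.domain := by
  induction j with
  | zero => exact fun _ _ => rfl
  | succ j ih =>
    rw [Function.iterate_succ_apply', Function.iterate_succ_apply']
    refine (dy_congr ih).trans fun p hp => ?_
    exact (hasDerivAt_eval_snd _ _ _).hasDerivWithinAt.derivWithin
      (uniqueDiffOn_Icc (by linarith) _ hp.2)

/-- The derivatives of order greater than the degree of a polynomial vanish. -/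
lemma derivLE_zero_of_polynomial (hl : 0 < P.len) {u : ℝ × ℝ → ℝ} {Q : MvPolynomial (Fin 2) ℝ}
    (hu : ∀ p ∈ P.domain, u p = eval ![p.1, p.2] Q) {n : ℕ} (hn : Q.totalDegree < n) :
    P.DerivLE u n P.domain 0 := by
  intro p hp i j hij
  have h1 : P.partialDeriv u i j p = eval ![p.1, p.2] ((pderiv 0)^[i] ((pderiv 1)^[j] Q)) := by
    unfold partialDeriv
    rw [dx_iterate_congr ((dy_iterate_congr hu j).trans (dy_iterate_eval hl Q j)) i hp,
      dx_iterate_eval hl _ i hp]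
  have h2 : (pderiv 0)^[i] ((pderiv 1)^[j] Q) = 0 := by
    ext m
    refine coeff_pderiv_iterate_eq_zero (n := 0)
      (coeff_pderiv_iterate_eq_zero (fun m hm => ?_) 1) 0 m
      (Nat.zero_le _)
    refine coeff_eq_zero_of_totalDegree_lt (lt_of_lt_of_le hn ?_)
    rw [Finsupp.degree_apply] at hm
    omega
  rw [h1, h2, map_zero, abs_zero]

end Polynomial

/-! ### Error of the finite difference solution -/

section Error

variable {P : FluxProblem} {N : ℕ} {F U V : ℤ × ℤ → ℝ} {u f g u₁ : ℝ × ℝ → ℝ} {δ : ℝ}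

open Classical in
/-- The right hand sides of the finite difference equations, one for each grid point. -/
noncomputable def schemeRhs (P : FluxProblem) (N : ℕ) (F : ℤ × ℤ → ℝ) (g u₁ : ℝ × ℝ → ℝ)
    (k : ℤ × ℤ) : ℝ :=
  if k ∈ interiorGrid N then Mh F k
  else if P.node N k ∈ P.fluxPart then P.fluxRhs N (sideOf N k) F g k else u₁ (P.node N k)

/-- The three families of equations form one square linear system, so solvability and uniqueness
become properties of `schemeOp`. -/
lemma isDiscreteSolution_iff (hl : 0 < P.len) (hflux : P.fluxPart ⊆ ⋃ s, P.openSide s)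
    (hN : 1 ≤ N) : P.IsDiscreteSolution N F g u₁ U ↔
      ∀ k ∈ grid N, P.schemeOp N U k = P.schemeRhs N F g u₁ k := by
  constructor
  · intro h k hk
    obtain hi | ⟨hi, hf⟩ | ⟨s, hs, hf⟩ := grid_cases hl hflux hN hk
    · rw [schemeOp_interior hi, schemeRhs, if_pos hi]
      exact h.interior k hi
    · rw [schemeOp_dirichlet hi hf, schemeRhs, if_neg hi, if_neg hf]
      exact h.dirichlet k hk ((node_mem_bdry_iff hl hN hk).2 hi) hf
    · rw [schemeOp_flux hs hf, schemeRhs, if_neg (not_mem_interiorGrid_of_mem_sideGrid hs),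
        if_pos hf, sideOf_eq hs]
      exact h.flux s k hs hf
  · intro h
    refine ⟨fun k hi => ?_, fun k hk hb hf => ?_, fun s k hs hf => ?_⟩
    · have := h k (interiorGrid_subset_grid hi)
      rwa [schemeOp_interior hi, schemeRhs, if_pos hi] at this
    · have hi := (node_mem_bdry_iff hl hN hk).1 hb
      have := h k hk
      rwa [schemeOp_dirichlet hi hf, schemeRhs, if_neg hi, if_neg hf] at this
    · have := h k (sideGrid_subset_grid s hs)
      rwa [schemeOp_flux hs hf, schemeRhs, if_neg (not_mem_interiorGrid_of_mem_sideGrid hs),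
        if_pos hf, sideOf_eq hs] at this

lemma IsDiscreteSolution.eqOn (hl : 0 < P.len) (hflux : P.fluxPart ⊆ ⋃ s, P.openSide s)
    (hK : P.K ≤ 0) (hσ : 0 ≤ P.σ) (hN : 1 ≤ N) (hU : P.IsDiscreteSolution N F g u₁ U)
    (hV : P.IsDiscreteSolution N F g u₁ V) : ∀ k ∈ grid N, V k = U k := by
  rw [isDiscreteSolution_iff hl hflux hN] at hU hV
  intro k hk
  have h := eq_zero_of_schemeOp_eq_zero hl hflux hK hσ hN (e := V + (-1 : ℝ) • U) (fun k hk => by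
    rw [schemeOp_add, schemeOp_smul, hU k hk, hV k hk]; ring) k hk
  simp only [Pi.add_apply, Pi.smul_apply, smul_eq_mul] at h
  linarith

lemma exists_isDiscreteSolution (hl : 0 < P.len) (hflux : P.fluxPart ⊆ ⋃ s, P.openSide s)
    (hK : P.K ≤ 0) (hσ : 0 ≤ P.σ) (hN : 1 ≤ N) (F : ℤ × ℤ → ℝ) (g u₁ : ℝ × ℝ → ℝ) :
    ∃ U, P.IsDiscreteSolution N F g u₁ U := by
  obtain ⟨U, hU⟩ := exists_schemeOp_eq hl hflux hK hσ hN (P.schemeRhs N F g u₁)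
  exact ⟨U, (isDiscreteSolution_iff hl hflux hN).2 hU⟩

lemma IsSolution.contDiffOn (hu : P.IsSolution u f g u₁) : ContDiffOn ℝ (6 : ℕ) u P.domain := by
  exact_mod_cast hu.smooth

lemma source_eq (hl : 0 < P.len) (hN : 1 ≤ N) (hu : P.IsSolution u f g u₁)
    (hF : P.IsSourceExtension N f δ F) : ∀ l ∈ grid N,
      F l = P.laplacian u (P.node N l) + P.K * u (P.node N l) := fun l hlg => by
  rw [hF.on_grid l hlg, hu.pde _ (node_mem_domain hl hN hlg)]

lemma abs_interiorOp_error_le (hl : 0 < P.len) (hN : 1 ≤ N) (hu : P.IsSolution u f g u₁)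
    (hF : P.IsSourceExtension N f δ F) (hU : P.IsDiscreteSolution N F g u₁ U) {M : ℝ}
    (hM : P.DerivLE u 6 P.domain M) {k : ℤ × ℤ} (hk : k ∈ interiorGrid N) :
    |P.interiorOp N (u ∘ P.node N + (-1 : ℝ) • U) k| ≤ 27 * M * P.h N ^ 4 := by
  have h1 := abs_Lh_sub_Mh_laplacian_le hl hN hu.contDiffOn hM hk
  have h2 : Mh F k = Mh (P.laplacian u ∘ P.node N) k + P.K * Mh (u ∘ P.node N) k := by
    rw [← Mh_add_smul]
    exact Mh_congr (fun l hlg => source_eq hl hN hu hF l hlg) hk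
  have h3 : P.interiorOp N U k = Mh F k := hU.interior k hk
  rw [interiorOp_add, interiorOp_smul, h3, h2]
  convert h1 using 2
  unfold interiorOp
  ring

lemma abs_fluxLhs_error_le (hl : 0 < P.len) (hK : P.K ≤ 0) (hN : 1 ≤ N)
    (hu : P.IsSolution u f g u₁) (hF : P.IsSourceExtension N f δ F)
    (hU : P.IsDiscreteSolution N F g u₁ U) {M₅ M₃ : ℝ} (hM₅ : P.DerivLE u 5 P.domain M₅)
    (hM₃ : P.DerivLE u 3 P.domain M₃) {s : SquareSide} {k : ℤ × ℤ} (hk : k ∈ sideGrid N s)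
    (hf : P.node N k ∈ P.fluxPart) :
    |P.fluxLhs N s (u ∘ P.node N + (-1 : ℝ) • U) k|
      ≤ 8256 * (M₅ + |P.K| * M₃) * P.h N ^ 3 + δ := by
  have h1 := abs_fluxLhs_sub_fluxRhs_le hl hK hN (hu.contDiffOn.of_le (by norm_cast)) hM₅ hM₃ hk
    (source_eq hl hN hu hF) (hF.outside s k hk hf)
    (hu.flux s _ (node_mem_openSide hl hN hk) hf)
  rw [fluxLhs_add, fluxLhs_smul, hU.flux s k hk hf, neg_one_mul, ← sub_eq_add_neg]
  exact h1

lemma error_dirichlet (hl : 0 < P.len) (hN : 1 ≤ N) (hu : P.IsSolution u f g u₁)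
    (hU : P.IsDiscreteSolution N F g u₁ U) {k : ℤ × ℤ} (hk : k ∈ grid N)
    (hi : k ∉ interiorGrid N) (hf : P.node N k ∉ P.fluxPart) :
    (u ∘ P.node N + (-1 : ℝ) • U) k = 0 := by
  have hb := (node_mem_bdry_iff (P := P) hl hN hk).2 hi
  simp [hU.dirichlet k hk hb hf, hu.dirichlet _ hb hf]

/-- The scheme is exact for polynomials of degree at most four. -/
lemma eq_of_polynomial (hl : 0 < P.len) (hflux : P.fluxPart ⊆ ⋃ s, P.openSide s)
    (hK : P.K = 0) (hσ : 0 ≤ P.σ) (hN : 1 ≤ N) {Q : MvPolynomial (Fin 2) ℝ}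
    (hQ : Q.totalDegree ≤ 4) (huQ : ∀ p ∈ P.domain, u p = MvPolynomial.eval ![p.1, p.2] Q)
    (hu : P.IsSolution u f g u₁) (hF : P.IsSourceExtension N f 0 F)
    (hU : P.IsDiscreteSolution N F g u₁ U) : ∀ k ∈ grid N, U k = u (P.node N k) := by
  have hM₆ := derivLE_zero_of_polynomial hl huQ (n := 6) (by omega)
  have hM₅ := derivLE_zero_of_polynomial hl huQ (n := 5) (by omega)
  -- Any finite bound will do, as it is multiplied by |K| = 0.
  obtain ⟨M₃, hM₃⟩ := bddAbove_partialDeriv (m := 3) hl hu.contDiffOn (by norm_num)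
  intro k hk
  have h := eq_zero_of_schemeOp_eq_zero hl hflux hK.le hσ hN
    (e := u ∘ P.node N + (-1 : ℝ) • U) (fun k hk => by
      obtain hi | ⟨hi, hf⟩ | ⟨s, hs, hf⟩ := grid_cases hl hflux hN hk
      · have := abs_interiorOp_error_le hl hN hu hF hU hM₆ hi
        rw [schemeOp_interior hi]
        simpa using this
      · rw [schemeOp_dirichlet hi hf]
        exact error_dirichlet hl hN hu hU hk hi hf
      · have := abs_fluxLhs_error_le hl hK.le hN hu hF hU hM₅ hM₃ hs hf
        rw [schemeOp_flux hs hf]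
        simpa [hK] using this) k hk
  simp only [Pi.add_apply, Pi.smul_apply, smul_eq_mul, Function.comp] at h
  linarith

/-- Fourth order convergence of the scheme. -/
lemma exists_abs_error_le (hl : 0 < P.len) (hflux : P.fluxPart ⊆ ⋃ s, P.openSide s)
    (hK : P.K ≤ 0) (hσ : 0 ≤ P.σ) (hseg : P.K = 0 → P.σ = 0 → P.HasDirichletSegment) (E : ℝ) :
    ∃ C : ℝ, ∀ N : ℕ, 1 ≤ N → ∀ (u f g u₁ : ℝ × ℝ → ℝ) (F U : ℤ × ℤ → ℝ),
      P.IsSolution u f g u₁ →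
      P.IsSourceExtension N f
        (E * max (P.derivBound u) (|P.K| * P.supDeriv 3 u P.bdry) * P.h N ^ 3) F →
      P.IsDiscreteSolution N F g u₁ U →
      ∀ k ∈ grid N, |u (P.node N k) - U k| ≤
        C * max (P.derivBound u) (|P.K| * P.supDeriv 3 u P.bdry) * P.h N ^ 4 := by
  obtain ⟨w, hw⟩ := exists_isBarrier hl hK hσ hseg
  obtain ⟨C₀, hC₀, hstab⟩ := hw.exists_stability hl hflux hK hσ
  -- 27 covers the interior residual and |E| the extension defect. The bracket comes from
  -- `derivLE_five` and from |K| times `derivLE_three`, whose boundary term is at most 3B.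
  set C₁ := 27 + 8256 * ((1 + P.len) + (3 + |P.K| * (2 * P.len ^ 2 * (1 + P.len)))) + |E| with hC₁
  refine ⟨C₀ * C₁, fun N hN u f g u₁ F U hu hF hU k hk => ?_⟩
  have hh := h_pos hl hN
  set B := max (P.derivBound u) (|P.K| * P.supDeriv 3 u P.bdry) with hB
  have hB1 : P.derivBound u ≤ B := le_max_left _ _
  have hB2 : |P.K| * P.supDeriv 3 u P.bdry ≤ B := le_max_right _ _
  have hB0 : 0 ≤ B := derivBound_nonneg.trans hB1
  have h27 : 27 ≤ C₁ := by
    have : 0 ≤ 8256 * ((1 + P.len) + (3 + |P.K| * (2 * P.len ^ 2 * (1 + P.len)))) + |E| := by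
      positivity
    linarith
  have hmain := hstab N hN (u ∘ P.node N + (-1 : ℝ) • U) (C₁ * B * P.h N ^ 4) (by positivity)
    (fun k hk => (abs_interiorOp_error_le hl hN hu hF hU (derivLE_six hl hu.contDiffOn) hk).trans
      (by have := derivBound_nonneg (P := P) (u := u); gcongr))
    (fun s k hk hf => by
      refine (abs_fluxLhs_error_le hl hK hN hu hF hU (derivLE_five hl hu.contDiffOn)
        (derivLE_three hl hu.contDiffOn) hk hf).trans ?_
      -- Stability tolerates τ/h at flux points, so with τ of order h⁴ a residual of order h³ is
      -- exactly admissible.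
      have h1 : C₁ * B * P.h N ^ 4 / P.h N = C₁ * B * P.h N ^ 3 := by
        field_simp
      rw [h1, ← add_mul]
      gcongr
      have e1 : (1 + P.len) * P.derivBound u ≤ (1 + P.len) * B := by gcongr
      have e2 : |P.K| * (2 * P.len ^ 2 * (1 + P.len)) * P.derivBound u
          ≤ |P.K| * (2 * P.len ^ 2 * (1 + P.len)) * B := by gcongr
      have e3 : E * B ≤ |E| * B := by gcongr; exact le_abs_self E
      rw [hC₁]
      linarith)
    (fun k hk hi hf => error_dirichlet hl hN hu hU hk hi hf) k hk
  calc |u (P.node N k) - U k| = |(u ∘ P.node N + (-1 : ℝ) • U) k| := by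
        simp [sub_eq_add_neg]
    _ ≤ C₀ * (C₁ * B * P.h N ^ 4) := hmain
    _ = C₀ * C₁ * B * P.h N ^ 4 := by ring

end Error

end FluxProblem

theorem mainTheorem1 (P : FluxProblem) (hlen : 0 < P.len)
    (hflux : P.fluxPart ⊆ ⋃ s, P.openSide s) (hK : P.K ≤ 0) (hσ : 0 ≤ P.σ) :
    -- the finite difference equations are uniquely solvable
    (∀ N : ℕ, 1 ≤ N → ∀ (F : ℤ × ℤ → ℝ) (g u₁ : ℝ × ℝ → ℝ),
      ∃ U, P.IsDiscreteSolution N F g u₁ U ∧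
        ∀ V, P.IsDiscreteSolution N F g u₁ V → ∀ k ∈ FluxProblem.grid N, V k = U k) ∧
    -- exactness for polynomials of degree at most four
    (P.K = 0 → P.σ = 0 → ∀ N : ℕ, 1 ≤ N → ∀ (u f g u₁ : ℝ × ℝ → ℝ) (F U : ℤ × ℤ → ℝ),
      (∃ Q : MvPolynomial (Fin 2) ℝ, Q.totalDegree ≤ 4 ∧
        ∀ p ∈ P.domain, u p = MvPolynomial.eval ![p.1, p.2] Q) →
      P.IsSolution u f g u₁ → P.IsSourceExtension N f 0 F →
      P.IsDiscreteSolution N F g u₁ U →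
      ∀ k ∈ FluxProblem.grid N, U k = u (P.node N k)) ∧
    -- fourth order convergence
    ((P.K = 0 → P.σ = 0 → P.HasDirichletSegment) →
      (∀ E : ℝ, ∃ C : ℝ, ∀ N : ℕ, 1 ≤ N → ∀ (u f g u₁ : ℝ × ℝ → ℝ) (F U : ℤ × ℤ → ℝ),
        P.IsSolution u f g u₁ →
        P.IsSourceExtension N f
          (E * max (P.derivBound u) (|P.K| * P.supDeriv 3 u P.bdry) * P.h N ^ 3) F →
        P.IsDiscreteSolution N F g u₁ U →
        ∀ k ∈ FluxProblem.grid N, |u (P.node N k) - U k| ≤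
          C * max (P.derivBound u) (|P.K| * P.supDeriv 3 u P.bdry) * P.h N ^ 4) ∧
      (∀ (u f g u₁ : ℝ × ℝ → ℝ), P.IsSolution u f g u₁ → 0 < P.derivBound u →
        ∀ E : ℝ, ∃ C : ℝ, ∀ N : ℕ, 1 ≤ N → ∀ F U : ℤ × ℤ → ℝ,
          P.IsSourceExtension N f (E * P.h N ^ 3) F →
          P.IsDiscreteSolution N F g u₁ U →
          ∀ k ∈ FluxProblem.grid N, |u (P.node N k) - U k| ≤
            C * P.derivBound u * P.h N ^ 4)) := by
  refine ⟨fun N hN F g u₁ => ?_, fun hK0 _ N hN u f g u₁ F U => ?_, fun hseg => ⟨fun E => ?_, ?_⟩⟩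
  · obtain ⟨U, hU⟩ := FluxProblem.exists_isDiscreteSolution hlen hflux hK hσ hN F g u₁
    exact ⟨U, hU, fun V hV => hU.eqOn hlen hflux hK hσ hN hV⟩
  · rintro ⟨Q, hQ, huQ⟩ hu hF hU
    exact FluxProblem.eq_of_polynomial hlen hflux hK0 hσ hN hQ huQ hu hF hU
  · exact FluxProblem.exists_abs_error_le hlen hflux hK hσ hseg E
  · intro u f g u₁ hu hB E
    set B := max (P.derivBound u) (|P.K| * P.supDeriv 3 u P.bdry) with hBdef
    have hBpos : 0 < B := hB.trans_le (le_max_left _ _)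
    -- For fixed u the number B is a positive constant: E h³ = (E/B) B h³, and B is exchanged for
    -- `derivBound` at the price of a constant depending on u.
    obtain ⟨C, hC⟩ := FluxProblem.exists_abs_error_le hlen hflux hK hσ hseg (E / B)
    refine ⟨C * B / P.derivBound u, fun N hN F U hF hU k hk => ?_⟩
    rw [div_mul_cancel₀ _ hB.ne']
    refine hC N hN u f g u₁ F U hu ?_ hU k hk
    rwa [← hBdef, div_mul_cancel₀ _ hBpos.ne']
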